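/- Let $\xi>-1$ be real, let $\mathbb D$ be the open unit disc and let $\mathcal A^2_\xi$ be the weighted Bergman space: the Hilbert space of holomorphic functions on $\mathbb D$ that are square integrable for $d\nu_\xi(z)=\frac{\xi+1}{\pi}(1-|z|^2)^\xi\,dz$, with $\langle f,g\rangle_\xi=\int_{\mathbb D}f\overline g\,d\nu_\xi$. Let $P(\mathbb D)\subseteq\mathcal A^2_\xi$ be the space of polynomials. Let $$\mathfrak{su}(1,1)=\left\{\begin{bmatrix} ia & b\\ \overline b & -ia\end{bmatrix}: a\in\mathbb R,\ b\in\mathbb C\right\},$$ and let $\pi_\xi$ be the (unitary) representation on $\mathcal A^2_\xi$ of the universal covering group of $\mathrm{SU}(1,1)$ given by $$\pi_\xi(x)f(z)=\frac{1}{(-\overline\beta z+\alpha)^{\xi+2}}\,f\!\left(\frac{\overline\alpha z-\beta}{-\overline\beta z+\alpha}\right)$$ for $x$ lying above $\begin{bmatrix}\alpha&\beta\\ \overline\beta&\overline\alpha\end{bmatrix}\in\mathrm{SU}(1,1)$. The power is defined by the branch of $\log(-\overline\beta z+\alpha)$ that is continuous in $x$ and in $z\in\mathbb D$ and vanishes when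 $x$ is the identity; for integer $\xi$ this is the discrete series representation of $\mathrm{SU}(1,1)$. Let $H^\infty_\xi$ be the space of smooth vectors of $\pi_\xi$, i.e. of those $v\in\mathcal A^2_\xi$ for which $x\mapsto\pi_\xi(x)v$ is smooth. For $X\in\mathfrak{su}(1,1)$ let $\pi_\xi(X)$ be the operator with domain $H^\infty_\xi$ given by $\pi_\xi(X)v=\frac{d}{dt}\big|_{t=0}\pi_\xi(\exp(tX))v$, and let $\Pi_\xi(X)$ be its closure. (1) Let $a,b\in\mathbb R$ and $c\in\mathbb C$, and let $L=(cz^2+az+\overline c)\frac{d}{dz}+((\xi+2)cz+b)$ with domain $P(\mathbb D)$. Then $L$ is densely defined and symmetric, and there are $X\in\mathfrak{su}(1,1)$ and $d\in\mathbb R$ such that $L$ is the restriction to $P(\mathbb D)$ of the operator $i\pi_\xi(X)+d$ with domain $H^\infty_\xi$. Moreover, $L$ and $\pi_\xi(X)$ are closable, and $\overline L=i\Pi_\xi(X)+d$ is self-adjoint. (2) Let $f,g\in\mathcal A^2_\xi$. If the first-order differential operator $L=f\frac{d}{dz}+g$ with domain $P(\mathbb D)$ is symmetric, then there are $X\in\mathfrak{su}(1,1)$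 and $d\in\mathbb R$ such that $L$ is the restriction to $P(\mathbb D)$ of $i\pi_\xi(X)+d$, the operators $L$ and $\pi_\xi(X)$ are closable, and $\overline L=i\Pi_\xi(X)+d$ is self-adjoint. -/

import Mathlib

noncomputable section

namespace Bergman

open MeasureTheory Metric Set Filter Topology
open scoped ComplexConjugate ENNReal ContDiff

/-- The open unit disc `𝔻`. -/
abbrev disc : Set ℂ := ball 0 1

/-- The measure `dν_ξ(z) = (ξ + 1)/π · (1 - |z|²)^ξ dz` on the unit disc. -/
def weightMeasure (ξ : ℝ) : Measure ℂ :=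
  (volume.restrict disc).withDensity
    fun z => ENNReal.ofReal ((ξ + 1) / Real.pi * (1 - ‖z‖ ^ 2) ^ ξ)

/-- The holomorphic functions on `𝔻` that are square integrable for `ν_ξ`. A function on `𝔻` is
represented by its extension by `0` to `ℂ`. -/
def bergmanSubmodule (ξ : ℝ) : Submodule ℂ (ℂ → ℂ) where
  carrier := {f | DifferentiableOn ℂ f disc ∧ (∀ z ∉ disc, f z = 0) ∧ MemLp f 2 (weightMeasure ξ)}
  zero_mem' := ⟨differentiableOn_const 0, fun _ _ => rfl, MemLp.zero⟩
  add_mem' := fun {f g} hf hg => ⟨hf.1.add hg.1,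
    fun z hz => by simp [hf.2.1 z hz, hg.2.1 z hz], hf.2.2.add hg.2.2⟩
  smul_mem' := fun c f hf => ⟨hf.1.const_smul c,
    fun z hz => by simp [hf.2.1 z hz], hf.2.2.const_smul c⟩

/-- The weighted Bergman space `A²_ξ`. -/
def A2 (ξ : ℝ) : Type := bergmanSubmodule ξ

instance (ξ : ℝ) : AddCommGroup (A2 ξ) := inferInstanceAs (AddCommGroup (bergmanSubmodule ξ))

instance (ξ : ℝ) : Module ℂ (A2 ξ) := inferInstanceAs (Module ℂ (bergmanSubmodule ξ))

/-- The function underlying an element of `A²_ξ`. -/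
def A2.toFun {ξ : ℝ} (f : A2 ξ) : ℂ → ℂ := f.1

instance (ξ : ℝ) : CoeFun (A2 ξ) fun _ => ℂ → ℂ := ⟨A2.toFun⟩

/-- The element of `A²_ξ` given by a function. -/
def A2.mk {ξ : ℝ} (f : ℂ → ℂ) (hf : f ∈ bergmanSubmodule ξ) : A2 ξ := ⟨f, hf⟩

theorem A2.mk_apply {ξ : ℝ} (f : ℂ → ℂ) (hf : f ∈ bergmanSubmodule ξ) (z : ℂ) :
    A2.mk f hf z = f z := rfl

theorem A2.mem {ξ : ℝ} (f : A2 ξ) : (f : ℂ → ℂ) ∈ bergmanSubmodule ξ := f.2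

theorem A2.ext {ξ : ℝ} {f g : A2 ξ} (h : ∀ z ∈ disc, f z = g z) : f = g := by
  refine Subtype.ext (funext fun z => ?_)
  by_cases hz : z ∈ disc
  · exact h z hz
  · exact (f.mem.2.1 z hz).trans (g.mem.2.1 z hz).symm

theorem A2.memLp {ξ : ℝ} (f : A2 ξ) : MemLp f 2 (weightMeasure ξ) := f.mem.2.2

theorem A2.differentiableOn {ξ : ℝ} (f : A2 ξ) : DifferentiableOn ℂ f disc := f.mem.1

theorem A2.coe_add {ξ : ℝ} (f g : A2 ξ) (z : ℂ) : (f + g) z = f z + g z := rfl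

theorem A2.coe_smul {ξ : ℝ} (c : ℂ) (f : A2 ξ) (z : ℂ) : (c • f) z = c * f z := rfl

/-- The class of `f` in `L²(ν_ξ)`. -/
def A2.toLp (ξ : ℝ) : A2 ξ →ₗ[ℂ] Lp ℂ 2 (weightMeasure ξ) where
  toFun f := MemLp.toLp f f.memLp
  map_add' f g := MemLp.toLp_add f.memLp g.memLp
  map_smul' c f := MemLp.toLp_const_smul c f.memLp

theorem density_pos {ξ : ℝ} (hξ : -1 < ξ) {z : ℂ} (hz : z ∈ disc) :
    0 < (ξ + 1) / Real.pi * (1 - ‖z‖ ^ 2) ^ ξ := by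
  have h1 : ‖z‖ < 1 := by simpa using hz
  have : 0 < 1 - ‖z‖ ^ 2 := by nlinarith [norm_nonneg z]
  have h2 : 0 < ξ + 1 := by linarith
  have := Real.pi_pos
  positivity

theorem measurable_density (ξ : ℝ) :
    Measurable fun z : ℂ => ENNReal.ofReal ((ξ + 1) / Real.pi * (1 - ‖z‖ ^ 2) ^ ξ) := by
  fun_prop

theorem ae_weightMeasure_iff {ξ : ℝ} (hξ : -1 < ξ) {p : ℂ → Prop} :
    (∀ᵐ z ∂weightMeasure ξ, p z) ↔ ∀ᵐ z ∂volume.restrict disc, p z := by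
  rw [weightMeasure, ae_withDensity_iff (measurable_density ξ)]
  refine ⟨fun h => ?_, fun h => h.mono fun z hz _ => hz⟩
  filter_upwards [h, ae_restrict_mem measurableSet_ball] with z hz hzd
  exact hz (by simpa using density_pos hξ hzd)

theorem eq_of_ae_eq {ξ : ℝ} (hξ : -1 < ξ) {f g : ℂ → ℂ} (hf : ContinuousOn f disc)
    (hg : ContinuousOn g disc) (h : f =ᵐ[weightMeasure ξ] g) : ∀ z ∈ disc, f z = g z := by
  have h' : f =ᵐ[volume.restrict disc] g := (ae_weightMeasure_iff hξ).1 h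
  exact Measure.eqOn_open_of_ae_eq h' isOpen_ball hf hg

theorem A2.toLp_injective {ξ : ℝ} (hξ : -1 < ξ) : Function.Injective (A2.toLp ξ) := by
  intro f g h
  have h' : (f : ℂ → ℂ) =ᵐ[weightMeasure ξ] g := (MemLp.toLp_eq_toLp_iff f.memLp g.memLp).1 h
  exact A2.ext (eq_of_ae_eq hξ f.differentiableOn.continuousOn g.differentiableOn.continuousOn h')

theorem isFiniteMeasure_weightMeasure {ξ : ℝ} (hξ : -1 < ξ) : IsFiniteMeasure (weightMeasure ξ) := by
  have key : Integrable (fun z : ℂ =>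
      (Iio (1 : ℝ)).indicator (fun r => (1 - r ^ 2) ^ ξ) ‖z‖) := by
    rw [integrable_fun_norm_addHaar volume (f := (Iio (1 : ℝ)).indicator fun r => (1 - r ^ 2) ^ ξ)]
    have hI : IntervalIntegrable (fun r : ℝ => (1 - r) ^ ξ + 1) volume 0 1 := by
      have h := (intervalIntegral.intervalIntegrable_rpow' (a := 0) (b := 1) hξ).comp_sub_left 1
      have h' : IntervalIntegrable (fun r : ℝ => (1 - r) ^ ξ) volume 0 1 := by
        simpa using h.symm
      exact h'.add intervalIntegrable_const
    have hI' : IntegrableOn (fun r : ℝ => (1 - r) ^ ξ + 1) (Ioo 0 1) :=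
      ((intervalIntegrable_iff_integrableOn_Ioc_of_le zero_le_one).1 hI).mono_set Ioo_subset_Ioc_self
    have hI2 : IntegrableOn (fun r : ℝ => r * (1 - r ^ 2) ^ ξ) (Ioo 0 1) := by
      refine Integrable.mono' hI' (by fun_prop) ?_
      filter_upwards [ae_restrict_mem measurableSet_Ioo] with r hr
      have h1 : 0 < 1 - r := by linarith [hr.2]
      have h2 : 1 - r ≤ 1 - r ^ 2 := by nlinarith [hr.1, hr.2]
      have h3 : (1 - r ^ 2) ^ ξ ≤ (1 - r) ^ ξ + 1 := by
        rcases le_or_gt 0 ξ with h | h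
        · have : (1 - r ^ 2) ^ ξ ≤ 1 :=
            Real.rpow_le_one (by linarith) (by nlinarith [hr.1]) h
          have := Real.rpow_nonneg h1.le ξ
          linarith
        · have := Real.rpow_le_rpow_of_nonpos h1 h2 h.le
          linarith
      have h4 : 0 ≤ (1 - r ^ 2) ^ ξ := Real.rpow_nonneg (by linarith) _
      rw [Real.norm_of_nonneg (mul_nonneg hr.1.le h4)]
      nlinarith [hr.1, hr.2]
    have : (fun y : ℝ => y ^ (Module.finrank ℝ ℂ - 1) •
        (Iio (1 : ℝ)).indicator (fun r => (1 - r ^ 2) ^ ξ) y) =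
        (Iio (1 : ℝ)).indicator (fun r : ℝ => r * (1 - r ^ 2) ^ ξ) := by
      funext y
      by_cases hy : y ∈ Iio (1 : ℝ)
      · simp [hy, Complex.finrank_real_complex]
      · simp [hy]
    rw [this, IntegrableOn, integrable_indicator_iff measurableSet_Iio, IntegrableOn,
      Measure.restrict_restrict measurableSet_Iio, Iio_inter_Ioi]
    exact hI2
  have key2 : IntegrableOn (fun z : ℂ => (ξ + 1) / Real.pi * (1 - ‖z‖ ^ 2) ^ ξ) disc := by
    rw [← integrable_indicator_iff measurableSet_ball]
    refine (key.const_mul ((ξ + 1) / Real.pi)).congr (Eventually.of_forall fun z => ?_)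
    by_cases hz : ‖z‖ < 1
    · simp [hz, indicator]
    · simp [hz, indicator]
  exact isFiniteMeasure_withDensity_ofReal key2.2

variable {ξ : ℝ} [hξ : Fact (-1 < ξ)]

instance : NormedAddCommGroup (A2 ξ) :=
  NormedAddCommGroup.induced (A2 ξ) (Lp ℂ 2 (weightMeasure ξ)) (A2.toLp ξ)
    (A2.toLp_injective hξ.out)

instance : InnerProductSpace ℂ (A2 ξ) where
  norm_smul_le c f := by
    change ‖A2.toLp ξ (c • f)‖ ≤ ‖c‖ * ‖A2.toLp ξ f‖
    rw [map_smul]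
    exact norm_smul_le _ _
  inner f g := inner ℂ (A2.toLp ξ f) (A2.toLp ξ g)
  norm_sq_eq_re_inner f := norm_sq_eq_re_inner (𝕜 := ℂ) (A2.toLp ξ f)
  conj_inner_symm f g := inner_conj_symm _ _
  add_left f g h := by rw [map_add, inner_add_left]
  smul_left f g c := by rw [map_smul, inner_smul_left]

/-- The inner product of `A²_ξ`; Mathlib's inner products are conjugate linear in the first
variable. -/
theorem A2.inner_eq (f g : A2 ξ) :
    inner ℂ f g = ∫ z, g z * conj (f z) ∂weightMeasure ξ := by
  change inner ℂ (A2.toLp ξ f) (A2.toLp ξ g) = _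
  rw [L2.inner_def]
  refine integral_congr_ae ?_
  filter_upwards [f.memLp.coeFn_toLp, g.memLp.coeFn_toLp] with z h1 h2
  change inner ℂ ((MemLp.toLp f f.memLp) z) ((MemLp.toLp g g.memLp) z) = _
  rw [h1, h2]
  rfl

theorem A2.norm_eq (f : A2 ξ) : ‖f‖ = (eLpNorm f 2 (weightMeasure ξ)).toReal :=
  Lp.norm_toLp f f.memLp

theorem A2.isometry_toLp : Isometry (A2.toLp ξ) :=
  AddMonoidHomClass.isometry_of_norm (A2.toLp ξ) fun _ => rfl


theorem mean_value_circle {h : ℂ → ℂ} {z : ℂ} {r : ℝ}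
    (hh : DiffContOnCl ℂ h (ball z |r|)) :
    ‖h z‖ₑ * volume (Ioo (-Real.pi) Real.pi) ≤
      ∫⁻ θ in Ioo (-Real.pi) Real.pi, ‖h (circleMap z r θ)‖ₑ := by
  have h1 : h z = (2 * Real.pi)⁻¹ • ∫ θ in (0 : ℝ)..2 * Real.pi, h (circleMap z r θ) := by
    rw [← Real.circleAverage_def]
    exact hh.circleAverage.symm
  have hper : Function.Periodic (fun θ => h (circleMap z r θ)) (2 * Real.pi) := fun θ => by
    simp only [periodic_circleMap z r θ]
  have h2 : ∫ θ in (0 : ℝ)..2 * Real.pi, h (circleMap z r θ) =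
      ∫ θ in Ioo (-Real.pi) Real.pi, h (circleMap z r θ) := by
    have := hper.intervalIntegral_add_eq 0 (-Real.pi)
    rw [zero_add] at this
    rw [this, show -Real.pi + 2 * Real.pi = Real.pi by ring,
      intervalIntegral.integral_of_le (by linarith [Real.pi_pos]), integral_Ioc_eq_integral_Ioo]
  have h3 : ‖(2 * Real.pi) • h z‖ₑ ≤
      ∫⁻ θ in Ioo (-Real.pi) Real.pi, ‖h (circleMap z r θ)‖ₑ := by
    rw [h1, h2, smul_inv_smul₀ (by positivity)]
    exact enorm_integral_le_lintegral_enorm _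
  refine le_trans (le_of_eq ?_) h3
  rw [enorm_smul, Real.volume_Ioo, mul_comm, Real.enorm_of_nonneg (by positivity)]
  congr 2
  ring

theorem mean_value_ball {h : ℂ → ℂ} {z : ℂ} {s : ℝ} {U : Set ℂ}
    (hh : DifferentiableOn ℂ h U) (hs : closedBall z s ⊆ U) :
    ‖h z‖ₑ * volume (ball z s) ≤ ∫⁻ w in ball z s, ‖h w‖ₑ := by
  have polar (F : ℂ → ℝ≥0∞) (hF : Measurable F) : ∫⁻ w, F w =
      ∫⁻ r in Ioi (0 : ℝ), ∫⁻ θ in Ioo (-Real.pi) Real.pi,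
        ENNReal.ofReal r * F (circleMap z r θ) := by
    rw [← lintegral_add_left_eq_self F z, ← Complex.lintegral_comp_polarCoord_symm,
      polarCoord_target, Measure.volume_eq_prod, ← Measure.prod_restrict, lintegral_prod]
    · simp only [Complex.polarCoord_symm_apply, circleMap, smul_eq_mul]
      simp only [Complex.exp_mul_I, ← Complex.ofReal_cos, ← Complex.ofReal_sin]
    · have : Measurable fun p : ℝ × ℝ => Complex.polarCoord.symm p := by
        simp only [Complex.polarCoord_symm_apply]
        fun_prop
      fun_prop
  have hm1 : Measurable ((ball z s).indicator fun w => ‖h w‖ₑ) := by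
    classical
    have := ContinuousOn.measurable_piecewise (s := ball z s)
      (hh.continuousOn.mono (ball_subset_closedBall.trans hs)).enorm
      (g := (0 : ℂ → ℝ≥0∞)) continuousOn_const measurableSet_ball
    rwa [piecewise_eq_indicator] at this
  have hm2 : Measurable ((ball z s).indicator fun _ => ‖h z‖ₑ) :=
    measurable_const.indicator measurableSet_ball
  rw [← setLIntegral_const, ← lintegral_indicator measurableSet_ball,
    ← lintegral_indicator measurableSet_ball, polar _ hm1, polar _ hm2]
  refine setLIntegral_mono' measurableSet_Ioi fun r hr => ?_
  have hr : 0 < r := hr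
  rw [lintegral_const_mul _ (by fun_prop), lintegral_const_mul _ (by fun_prop)]
  gcongr ENNReal.ofReal r * ?_
  have hmem (θ : ℝ) : circleMap z r θ ∈ ball z s ↔ r < s := by
    simp [mem_ball, dist_eq_norm, circleMap, abs_of_pos hr]
  by_cases hrs : r < s
  · simp only [indicator, hmem, hrs, if_true]
    rw [setLIntegral_const]
    refine mean_value_circle ((hh.mono ?_).diffContOnCl (s := ball z |r|))
    rw [abs_of_pos hr, closure_ball _ hr.ne']
    exact (closedBall_subset_closedBall hrs.le).trans hs
  · simp [indicator, hmem, hrs]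

theorem exists_pointwise_bound {r : ℝ} (hr : r < 1) :
    ∃ C : ℝ, ∀ (f : A2 ξ), ∀ z ∈ closedBall (0 : ℂ) r, ‖f z‖ ≤ C * ‖f‖ := by
  obtain ⟨R, hrR, hR⟩ := exists_between hr
  have hK : IsCompact (closedBall (0 : ℂ) R) := isCompact_closedBall 0 R
  have hKd : closedBall (0 : ℂ) R ⊆ disc := closedBall_subset_ball hR
  -- the density is bounded below on compact subsets of the disc
  obtain ⟨m, hm, hmK⟩ : ∃ m : ℝ, 0 < m ∧ ∀ w ∈ closedBall (0 : ℂ) R,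
      m ≤ (ξ + 1) / Real.pi * (1 - ‖w‖ ^ 2) ^ ξ := by
    rcases (closedBall (0 : ℂ) R).eq_empty_or_nonempty with he | hne
    · exact ⟨1, one_pos, by simp [he]⟩
    · have hc : ContinuousOn (fun w : ℂ => (ξ + 1) / Real.pi * (1 - ‖w‖ ^ 2) ^ ξ)
          (closedBall (0 : ℂ) R) := by
        refine continuousOn_const.mul (ContinuousOn.rpow_const (by fun_prop) fun w hw => Or.inl ?_)
        have h1 : ‖w‖ < 1 := by simpa using hKd hw
        nlinarith [norm_nonneg w]
      obtain ⟨w0, hw0, hmin⟩ := hK.exists_isMinOn hne hc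
      exact ⟨_, density_pos hξ.out (hKd hw0), fun w hw => hmin hw⟩
  set s := R - r with hs
  have hs0 : 0 < s := by linarith
  have hV : volume (ball (0 : ℂ) s) ≠ 0 := (measure_ball_pos _ _ hs0).ne'
  have hV' : volume (ball (0 : ℂ) s) ≠ ⊤ := measure_ball_lt_top.ne
  set V := (volume (ball (0 : ℂ) s)).toReal with hVdef
  have hVpos : 0 < V := ENNReal.toReal_pos hV hV'
  refine ⟨√((m * V)⁻¹), fun f z hz => ?_⟩
  have hsub : closedBall z s ⊆ closedBall (0 : ℂ) R := by
    refine closedBall_subset_closedBall' ?_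
    have : dist z 0 ≤ r := hz
    linarith
  have h1 := mean_value_ball (h := fun w => f w ^ 2) (z := z) (s := s)
    (f.differentiableOn.pow 2) (hsub.trans hKd)
  have h2 : ENNReal.ofReal m * ∫⁻ w in ball z s, ‖f w ^ 2‖ₑ ≤
      ∫⁻ w, ‖f w‖ₑ ^ 2 ∂weightMeasure ξ := by
    rw [weightMeasure, lintegral_withDensity_eq_lintegral_mul₀ (measurable_density ξ).aemeasurable
      (((f.differentiableOn.continuousOn.aestronglyMeasurable measurableSet_ball).enorm).pow_const 2),
      ← lintegral_const_mul' _ _ ENNReal.ofReal_ne_top]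
    refine (setLIntegral_mono' measurableSet_ball (fun w hw => ?_)).trans
      (lintegral_mono_set (ball_subset_closedBall.trans (hsub.trans hKd)))
    rw [enorm_pow]
    exact mul_le_mul_left (ENNReal.ofReal_le_ofReal (hmK w (hsub (ball_subset_closedBall hw)))) _
  have h3 : ∫⁻ w, ‖f w‖ₑ ^ 2 ∂weightMeasure ξ = ENNReal.ofReal (‖f‖ ^ 2) := by
    have h4 : eLpNorm f 2 (weightMeasure ξ) ≠ ⊤ := f.memLp.2.ne
    rw [A2.norm_eq, ENNReal.ofReal_pow ENNReal.toReal_nonneg, ENNReal.ofReal_toReal h4]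
    rw [eLpNorm_eq_lintegral_rpow_enorm_toReal two_ne_zero ENNReal.ofNat_ne_top]
    rw [← ENNReal.rpow_natCast, ← ENNReal.rpow_mul]
    norm_num
  rw [Measure.addHaar_ball_center] at h1
  have h5 : ENNReal.ofReal (m * V * ‖f z‖ ^ 2) ≤ ENNReal.ofReal (‖f‖ ^ 2) := by
    rw [← h3]
    refine le_trans ?_ h2
    refine le_trans (le_of_eq ?_) (mul_le_mul_right h1 _)
    rw [mul_assoc, ENNReal.ofReal_mul hm.le, ENNReal.ofReal_mul hVpos.le, hVdef,
      ENNReal.ofReal_toReal hV', enorm_pow, mul_comm (volume _), ← ofReal_norm,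
      ENNReal.ofReal_pow (norm_nonneg _)]
  have h6 : m * V * ‖f z‖ ^ 2 ≤ ‖f‖ ^ 2 := (ENNReal.ofReal_le_ofReal_iff (by positivity)).1 h5
  have hmV : 0 < m * V := by positivity
  have h7 : ‖f z‖ ^ 2 ≤ (√((m * V)⁻¹) * ‖f‖) ^ 2 := by
    rw [mul_pow, Real.sq_sqrt (by positivity), ← div_eq_inv_mul, le_div_iff₀ hmV]
    linarith
  exact (pow_le_pow_iff_left₀ (norm_nonneg _) (by positivity) two_ne_zero).1 h7

instance : CompleteSpace (A2 ξ) := by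
  have hiso := A2.isometry_toLp (ξ := ξ)
  refine (completeSpace_iff_isComplete_range hiso.isUniformInducing).2 (IsClosed.isComplete ?_)
  refine isClosed_of_closure_subset fun g hg => ?_
  obtain ⟨v, hv, hvg⟩ := mem_closure_iff_seq_limit.1 hg
  choose u hu using hv
  have hCu : CauchySeq u := by
    have : CauchySeq (A2.toLp ξ ∘ u) := by
      have : A2.toLp ξ ∘ u = v := funext hu
      rw [this]
      exact hvg.cauchySeq
    exact (hiso.isUniformInducing.cauchy_map_iff (F := map u atTop)).1 (by rwa [map_map])
  have hbound (r : ℝ) (hr : r < 1) :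
      UniformCauchySeqOn (fun n => (u n : ℂ → ℂ)) atTop (closedBall 0 r) := by
    obtain ⟨C, hC⟩ := exists_pointwise_bound (ξ := ξ) hr
    rw [Metric.uniformCauchySeqOn_iff]
    intro ε hε
    obtain ⟨N, hN⟩ := Metric.cauchySeq_iff.1 hCu (ε / (|C| + 1)) (by positivity)
    refine ⟨N, fun m hm n hn z hz => ?_⟩
    have h1 := hC (u m - u n) z hz
    have h2 : (u m - u n) z = u m z - u n z := rfl
    have h3 := hN m hm n hn
    rw [dist_eq_norm] at h3 ⊢
    rw [h2] at h1
    rw [lt_div_iff₀ (by positivity)] at h3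
    nlinarith [le_abs_self C, norm_nonneg (u m - u n)]
  have hpt (z : ℂ) (hz : z ∈ disc) : ∃ w, Tendsto (fun n => u n z) atTop (𝓝 w) := by
    have hz' : ‖z‖ < 1 := by simpa using hz
    exact cauchySeq_tendsto_of_complete ((hbound ‖z‖ hz').cauchySeq (by simp))
  choose! F hF using hpt
  have hloc : TendstoLocallyUniformlyOn (fun n => (u n : ℂ → ℂ)) F atTop disc := by
    rw [tendstoLocallyUniformlyOn_iff_forall_isCompact isOpen_ball]
    intro K hK hKc
    obtain ⟨r, hr, hKr⟩ : ∃ r < 1, K ⊆ closedBall (0 : ℂ) r := by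
      obtain ⟨r, hr, h⟩ := exists_lt_subset_ball hKc.isClosed hK
      exact ⟨r, hr, h.trans ball_subset_closedBall⟩
    exact ((hbound r hr).mono hKr).tendstoUniformlyOn_of_tendsto fun z hz => hF z (hK hz)
  have hFd : DifferentiableOn ℂ F disc :=
    hloc.differentiableOn (Eventually.of_forall fun n => (u n).differentiableOn) isOpen_ball
  -- the locally uniform limit is the limit in `L²`
  have hae : disc.indicator F =ᵐ[weightMeasure ξ] g := by
    obtain ⟨ns, hns, hlim⟩ := (tendstoInMeasure_of_tendsto_Lp hvg).exists_seq_tendsto_ae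
    have h1 : ∀ᵐ z ∂weightMeasure ξ, ∀ n, v n z = u n z := ae_all_iff.2 fun n => by
      rw [← hu n]
      exact (u n).memLp.coeFn_toLp
    have h2 : ∀ᵐ z ∂weightMeasure ξ, z ∈ disc :=
      (ae_weightMeasure_iff hξ.out).2 (ae_restrict_mem measurableSet_ball)
    filter_upwards [hlim, h1, h2] with z hz hz1 hz2
    rw [indicator_of_mem hz2]
    have h3 := (hF z hz2).comp hns.tendsto_atTop
    simp only [hz1] at hz
    exact tendsto_nhds_unique h3 hz
  have hmem : MemLp (disc.indicator F) 2 (weightMeasure ξ) := (memLp_congr_ae hae).2 (Lp.memLp g)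
  refine ⟨A2.mk (disc.indicator F) ⟨hFd.congr fun z hz => indicator_of_mem hz F,
    fun z hz => indicator_of_notMem hz F, hmem⟩, ?_⟩
  exact Lp.ext (hmem.coeFn_toLp.trans hae)

/-! ### Polynomials and first-order differential operators -/

theorem polynomial_mul_mem {ξ : ℝ} (p : Polynomial ℂ) {f : ℂ → ℂ}
    (hf : f ∈ bergmanSubmodule ξ) : (fun z => p.eval z * f z) ∈ bergmanSubmodule ξ := by
  refine ⟨p.differentiable.differentiableOn.mul hf.1, fun z hz => by simp [hf.2.1 z hz], ?_⟩
  obtain ⟨C, hC⟩ := (isCompact_closedBall (0 : ℂ) 1).exists_bound_of_continuousOn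
    (f := fun z => p.eval z) p.continuous.continuousOn
  refine hf.2.2.of_le_mul (c := C)
    (p.continuous.aestronglyMeasurable.mul hf.2.2.aestronglyMeasurable)
    (Eventually.of_forall fun z => ?_)
  rw [norm_mul]
  by_cases hz : z ∈ disc
  · exact mul_le_mul_of_nonneg_right (hC z (ball_subset_closedBall hz)) (norm_nonneg _)
  · simp [hf.2.1 z hz]

/-- A polynomial, as an element of `A²_ξ`. -/
def ofPoly (ξ : ℝ) [hξ : Fact (-1 < ξ)] (p : Polynomial ℂ) : A2 ξ :=
  A2.mk (disc.indicator fun z => p.eval z) <| by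
    have := isFiniteMeasure_weightMeasure hξ.out
    have h1 : disc.indicator (fun _ => (1 : ℂ)) ∈ bergmanSubmodule ξ :=
      ⟨(differentiableOn_const (1 : ℂ)).congr fun z hz => indicator_of_mem hz _,
        fun z hz => indicator_of_notMem hz _,
        (memLp_const (1 : ℂ)).indicator measurableSet_ball⟩
    convert polynomial_mul_mem p h1 using 1
    funext z
    by_cases hz : z ∈ disc
    · simp only [indicator_of_mem hz, mul_one]
    · simp only [indicator_of_notMem hz, mul_zero]

/-- The space `P(𝔻)` of polynomials on `𝔻`, as a subspace of `A²_ξ`. -/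
def polySubmodule (ξ : ℝ) : Submodule ℂ (A2 ξ) where
  carrier := {h | ∃ p : Polynomial ℂ, ∀ z ∈ disc, h z = p.eval z}
  zero_mem' := ⟨0, fun z _ => by simp only [Polynomial.eval_zero]; rfl⟩
  add_mem' := by
    rintro f g ⟨p, hp⟩ ⟨q, hq⟩
    exact ⟨p + q, fun z hz => by rw [A2.coe_add, hp z hz, hq z hz, Polynomial.eval_add]⟩
  smul_mem' := by
    rintro c f ⟨p, hp⟩
    exact ⟨c • p, fun z hz => by rw [A2.coe_smul, hp z hz, Polynomial.eval_smul, smul_eq_mul]⟩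

theorem A2.differentiableAt {ξ : ℝ} (f : A2 ξ) {z : ℂ} (hz : z ∈ disc) :
    DifferentiableAt ℂ f z :=
  f.differentiableOn.differentiableAt (isOpen_ball.mem_nhds hz)

theorem diffOp_mem {ξ : ℝ} (f g : A2 ξ) {h : A2 ξ} (hh : h ∈ polySubmodule ξ) :
    disc.indicator (fun z => f z * deriv h z + g z * h z) ∈ bergmanSubmodule ξ := by
  obtain ⟨p, hp⟩ := hh
  convert (bergmanSubmodule ξ).add_mem (polynomial_mul_mem p.derivative f.mem)
    (polynomial_mul_mem p g.mem) using 1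
  funext z
  by_cases hz : z ∈ disc
  · have hd : deriv h z = p.derivative.eval z := by
      rw [← Polynomial.deriv]
      exact EventuallyEq.deriv_eq (eventually_of_mem (isOpen_ball.mem_nhds hz) hp)
    rw [indicator_of_mem hz, hd, hp z hz, mul_comm, mul_comm (g z)]
    rfl
  · rw [indicator_of_notMem hz, Pi.add_apply, f.mem.2.1 z hz, g.mem.2.1 z hz]
    simp

/-- The first-order differential operator `L = f d/dz + g` on `A²_ξ`, where `f, g ∈ A²_ξ`, with
domain `P(𝔻)`. -/
def diffOp {ξ : ℝ} (f g : A2 ξ) : A2 ξ →ₗ.[ℂ] A2 ξ where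
  domain := polySubmodule ξ
  toFun :=
    { toFun := fun h => A2.mk (disc.indicator fun z => f z * deriv (h : A2 ξ) z + g z * (h : A2 ξ) z)
        (diffOp_mem f g h.2)
      map_add' := fun h k => A2.ext fun z hz => by
        have hd : deriv ((h + k : A2 ξ) : ℂ → ℂ) z =
            deriv (h : A2 ξ) z + deriv (k : A2 ξ) z :=
          deriv_add ((h : A2 ξ).differentiableAt hz) ((k : A2 ξ).differentiableAt hz)
        rw [A2.coe_add]
        simp only [A2.mk_apply]
        simp only [indicator_of_mem hz, Submodule.coe_add, hd, A2.coe_add]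
        ring
      map_smul' := fun c h => A2.ext fun z hz => by
        have hd : deriv ((c • (h : A2 ξ) : A2 ξ) : ℂ → ℂ) z = c * deriv (h : A2 ξ) z :=
          deriv_const_mul c ((h : A2 ξ).differentiableAt hz)
        rw [RingHom.id_apply, A2.coe_smul]
        simp only [A2.mk_apply]
        simp only [indicator_of_mem hz, Submodule.coe_smul, hd, A2.coe_smul]
        ring }

/-! ### The group `SU(1,1)`, its universal covering group and the representation `π_ξ` -/

/-- The manifold underlying the universal covering group of `SU(1,1)`, in the global coordinates
`(θ, β) ∈ ℝ × ℂ`, where `(θ, β)` lies above the matrix with entries `α = √(1 + |β|²) exp(iθ)` and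
`β`, see `UniversalCover.toSU`. -/
abbrev UniversalCover : Type := ℝ × ℂ

namespace UniversalCover

/-- The entry `α` of the matrix below a point of the universal covering group. -/
def alpha (x : UniversalCover) : ℂ := √(1 + ‖x.2‖ ^ 2) * Complex.exp (x.1 * Complex.I)

/-- The entry `β` of the matrix below a point of the universal covering group. -/
def beta (x : UniversalCover) : ℂ := x.2

/-- The covering map to `SU(1,1)`. -/
def toSU (x : UniversalCover) : Matrix (Fin 2) (Fin 2) ℂ :=
  !![x.alpha, x.beta; conj x.beta, conj x.alpha]

theorem norm_alpha_sq (x : UniversalCover) : ‖x.alpha‖ ^ 2 = 1 + ‖x.beta‖ ^ 2 := by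
  rw [alpha, norm_mul, Complex.norm_exp_ofReal_mul_I, mul_one, Complex.norm_real, Real.norm_eq_abs,
    sq_abs, Real.sq_sqrt (by positivity), beta]

theorem norm_beta_lt (x : UniversalCover) : ‖x.beta‖ < ‖x.alpha‖ := by
  have := x.norm_alpha_sq
  exact lt_of_pow_lt_pow_left₀ 2 (norm_nonneg _) (by linarith)

theorem alpha_ne_zero (x : UniversalCover) : x.alpha ≠ 0 :=
  norm_pos_iff.1 ((norm_nonneg _).trans_lt x.norm_beta_lt)

theorem alpha_mul_conj (x : UniversalCover) :
    x.alpha * conj x.alpha = 1 + x.beta * conj x.beta := by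
  rw [Complex.mul_conj', Complex.mul_conj', ← Complex.ofReal_pow, x.norm_alpha_sq]
  push_cast
  rfl

/-- The factor `-β̄ z + α`. -/
def factor (x : UniversalCover) (z : ℂ) : ℂ := -conj x.beta * z + x.alpha

/-- The branch of `log (-β̄ z + α)`, continuous in the point `(θ, β)` of the universal covering group
and in `z ∈ 𝔻`, which vanishes at the identity. -/
def logFactor (x : UniversalCover) (z : ℂ) : ℂ :=
  Real.log √(1 + ‖x.2‖ ^ 2) + x.1 * Complex.I + Complex.log (1 - conj x.beta / x.alpha * z)

/-- The action `z ↦ (ᾱ z - β) / (-β̄ z + α)` of the inverse of a group element on `𝔻`. -/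
def moebius (x : UniversalCover) (z : ℂ) : ℂ := (conj x.alpha * z - x.beta) / x.factor z

theorem norm_quotient_lt (x : UniversalCover) {z : ℂ} (hz : z ∈ disc) :
    ‖conj x.beta / x.alpha * z‖ < 1 := by
  have hz' : ‖z‖ < 1 := by simpa using hz
  have h1 : ‖conj x.beta / x.alpha‖ < 1 := by
    rw [norm_div, RCLike.norm_conj, div_lt_one (norm_pos_iff.2 x.alpha_ne_zero)]
    exact x.norm_beta_lt
  rw [norm_mul]
  nlinarith [norm_nonneg z, norm_nonneg (conj x.beta / x.alpha)]

theorem one_sub_mem_slitPlane (x : UniversalCover) {z : ℂ} (hz : z ∈ disc) :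
    1 - conj x.beta / x.alpha * z ∈ Complex.slitPlane := by
  have := x.norm_quotient_lt hz
  rw [sub_eq_add_neg]
  exact Complex.mem_slitPlane_of_norm_lt_one (by rwa [norm_neg])

theorem exp_logFactor (x : UniversalCover) {z : ℂ} (hz : z ∈ disc) :
    Complex.exp (x.logFactor z) = x.factor z := by
  have h1 : 1 - conj x.beta / x.alpha * z ≠ 0 :=
    Complex.slitPlane_ne_zero (x.one_sub_mem_slitPlane hz)
  have h2 : (0 : ℝ) < √(1 + ‖x.2‖ ^ 2) := by positivity
  have h3 : Complex.exp (Real.log √(1 + ‖x.2‖ ^ 2) : ℝ) * Complex.exp (x.1 * Complex.I) =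
      x.alpha := by
    rw [← Complex.ofReal_exp, Real.exp_log h2, alpha]
  rw [logFactor, Complex.exp_add, Complex.exp_add, h3, Complex.exp_log h1, factor]
  field_simp [x.alpha_ne_zero]
  ring

theorem factor_ne_zero (x : UniversalCover) {z : ℂ} (hz : z ∈ disc) : x.factor z ≠ 0 := by
  rw [← x.exp_logFactor hz]
  exact Complex.exp_ne_zero _

theorem one_sub_norm_moebius_sq (x : UniversalCover) {z : ℂ} (hz : z ∈ disc) :
    1 - ‖x.moebius z‖ ^ 2 = (1 - ‖z‖ ^ 2) / ‖x.factor z‖ ^ 2 := by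
  have h0 : ‖x.factor z‖ ^ 2 ≠ 0 := pow_ne_zero 2 (norm_ne_zero_iff.2 (x.factor_ne_zero hz))
  rw [moebius, norm_div, div_pow, eq_div_iff h0, sub_mul, one_mul, div_mul_cancel₀ _ h0]
  apply Complex.ofReal_injective
  push_cast
  simp only [← Complex.mul_conj', factor, map_add, map_sub, map_mul, map_neg, Complex.conj_conj]
  linear_combination (1 - z * conj z) * x.alpha_mul_conj

theorem moebius_mem (x : UniversalCover) {z : ℂ} (hz : z ∈ disc) : x.moebius z ∈ disc := by
  have hz' : ‖z‖ < 1 := by simpa using hz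
  have h1 := x.one_sub_norm_moebius_sq hz
  have h2 : 0 < ‖x.factor z‖ := norm_pos_iff.2 (x.factor_ne_zero hz)
  have h3 : 0 < (1 - ‖z‖ ^ 2) / ‖x.factor z‖ ^ 2 :=
    div_pos (by nlinarith [norm_nonneg z]) (by positivity)
  have h4 : ‖x.moebius z‖ ^ 2 < 1 := by linarith
  simpa using (sq_lt_one_iff₀ (norm_nonneg _)).1 h4

theorem hasDerivAt_moebius (x : UniversalCover) {z : ℂ} (hz : z ∈ disc) :
    HasDerivAt x.moebius (1 / x.factor z ^ 2) z := by
  have h1 : HasDerivAt (fun z => conj x.alpha * z - x.beta) (conj x.alpha) z := by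
    simpa using ((hasDerivAt_id z).const_mul (conj x.alpha)).sub_const x.beta
  have h2 : HasDerivAt (fun z => -conj x.beta * z + x.alpha) (-conj x.beta) z := by
    simpa using ((hasDerivAt_id z).const_mul (-conj x.beta)).add_const x.alpha
  have h3 := h1.fun_div h2 (x.factor_ne_zero hz)
  have h4 : conj x.alpha * (-conj x.beta * z + x.alpha) -
      (conj x.alpha * z - x.beta) * -conj x.beta = 1 := by
    linear_combination x.alpha_mul_conj
  rw [h4] at h3
  exact h3

/-- Coordinates of the inverse of a group element. -/
def inv (x : UniversalCover) : UniversalCover := (-x.1, -x.2)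

theorem moebius_inv_moebius (x : UniversalCover) {z : ℂ} (hz : z ∈ disc) :
    x.inv.moebius (x.moebius z) = z := by
  have ha : x.inv.alpha = conj x.alpha := by
    simp only [alpha, inv, norm_neg, map_mul, Complex.conj_ofReal, ← Complex.exp_conj,
      Complex.conj_I]
    congr 2
    push_cast
    ring
  have hb : x.inv.beta = -x.beta := rfl
  have h0 := x.factor_ne_zero hz
  have h1 := x.inv.factor_ne_zero (x.moebius_mem hz)
  rw [moebius, div_eq_iff h1]
  simp only [factor, ha, hb, map_neg, Complex.conj_conj] at h1 ⊢
  rw [moebius]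
  field_simp
  simp only [factor]
  ring

end UniversalCover

/-- `π_ξ(x) f (z) = (-β̄ z + α)^{-(ξ + 2)} f ((ᾱ z - β) / (-β̄ z + α))` for `z ∈ 𝔻`. -/
def repFun (ξ : ℝ) (x : UniversalCover) (f : ℂ → ℂ) : ℂ → ℂ :=
  disc.indicator fun z => Complex.exp (-(ξ + 2) * x.logFactor z) * f (x.moebius z)

theorem norm_exp_logFactor (ξ : ℝ) (x : UniversalCover) {z : ℂ} (hz : z ∈ disc) :
    ‖Complex.exp (-(ξ + 2) * x.logFactor z)‖ = ‖x.factor z‖ ^ (-(ξ + 2)) := by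
  rw [← x.exp_logFactor hz, Complex.norm_exp, Complex.norm_exp, ← Real.exp_mul]
  congr 1
  have : (-((ξ : ℂ) + 2)) = ((-(ξ + 2) : ℝ) : ℂ) := by push_cast; ring
  rw [this, Complex.re_ofReal_mul, mul_comm]

theorem differentiableOn_repFun {ξ : ℝ} (x : UniversalCover) {f : ℂ → ℂ}
    (hf : DifferentiableOn ℂ f disc) : DifferentiableOn ℂ (repFun ξ x f) disc := by
  refine DifferentiableOn.congr (f := fun z => Complex.exp (-(ξ + 2) * x.logFactor z) *
    f (x.moebius z)) ?_ fun z hz => indicator_of_mem hz _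
  refine DifferentiableOn.mul (fun z hz => ?_) ?_
  · have h1 : DifferentiableAt ℂ (fun z => Complex.log (1 - conj x.beta / x.alpha * z)) z :=
      DifferentiableAt.clog (by fun_prop) (x.one_sub_mem_slitPlane hz)
    have h2 : DifferentiableAt ℂ x.logFactor z := h1.const_add _
    exact (h2.const_mul _).cexp.differentiableWithinAt
  · exact hf.comp (fun z hz => (x.hasDerivAt_moebius hz).differentiableAt.differentiableWithinAt)
      fun z hz => x.moebius_mem hz

theorem lintegral_repFun {ξ : ℝ} (hξ : -1 < ξ) (x : UniversalCover) (f : ℂ → ℂ)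
    (hf : ContinuousOn f disc) (hg : ContinuousOn (repFun ξ x f) disc) :
    ∫⁻ z, ‖repFun ξ x f z‖ₑ ^ 2 ∂weightMeasure ξ = ∫⁻ z, ‖f z‖ₑ ^ 2 ∂weightMeasure ξ := by
  have himage : x.moebius '' disc = disc := by
    refine Subset.antisymm (image_subset_iff.2 fun z hz => x.moebius_mem hz) fun z hz => ?_
    refine ⟨x.inv.moebius z, x.inv.moebius_mem hz, ?_⟩
    have := x.inv.moebius_inv_moebius hz
    simpa [UniversalCover.inv] using this
  have hinj : InjOn x.moebius disc := fun z hz w hw h => by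
    rw [← x.moebius_inv_moebius hz, h, x.moebius_inv_moebius hw]
  have haux (g : ℂ → ℂ) (hg : ContinuousOn g disc) :
      ∫⁻ z, ‖g z‖ₑ ^ 2 ∂weightMeasure ξ =
      ∫⁻ z in disc, ENNReal.ofReal ((ξ + 1) / Real.pi * (1 - ‖z‖ ^ 2) ^ ξ * ‖g z‖ ^ 2) := by
    rw [weightMeasure, lintegral_withDensity_eq_lintegral_mul₀ (measurable_density ξ).aemeasurable
      ((hg.aestronglyMeasurable measurableSet_ball).enorm.pow_const 2)]
    refine setLIntegral_congr_fun measurableSet_ball fun z hz => ?_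
    change ENNReal.ofReal ((ξ + 1) / Real.pi * (1 - ‖z‖ ^ 2) ^ ξ) * ‖g z‖ₑ ^ 2 = _
    rw [ENNReal.ofReal_mul (density_pos hξ hz).le, ENNReal.ofReal_pow (norm_nonneg _), ofReal_norm]
  rw [haux _ hf, haux _ hg]
  conv_rhs => rw [← himage]
  rw [lintegral_image_eq_lintegral_abs_det_fderiv_mul volume measurableSet_ball
    (f' := fun z => (ContinuousLinearMap.toSpanSingleton ℂ (1 / x.factor z ^ 2)).restrictScalars ℝ)
    (fun z hz => ((x.hasDerivAt_moebius hz).hasFDerivAt.restrictScalars ℝ).hasFDerivWithinAt) hinj]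
  refine setLIntegral_congr_fun measurableSet_ball fun z hz => ?_
  have hz' : ‖z‖ < 1 := by simpa using hz
  have hJ : 0 < ‖x.factor z‖ := norm_pos_iff.2 (x.factor_ne_zero hz)
  have h1 : 0 ≤ 1 - ‖z‖ ^ 2 := by nlinarith [norm_nonneg z]
  have hdet : |((ContinuousLinearMap.toSpanSingleton ℂ (1 / x.factor z ^ 2)).restrictScalars
      ℝ).det| = (‖x.factor z‖ ^ 4)⁻¹ := by
    simp [ContinuousLinearMap.det, LinearMap.det_restrictScalars, Algebra.norm_complex_eq,
      Complex.normSq_eq_norm_sq, ← pow_mul]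
  simp only [hdet, repFun, indicator_of_mem hz]
  rw [← ENNReal.ofReal_mul (by positivity)]
  congr 1
  rw [x.one_sub_norm_moebius_sq hz, norm_mul, norm_exp_logFactor ξ x hz,
    Real.div_rpow h1 (by positivity), mul_pow, ← Real.rpow_natCast, ← Real.rpow_natCast,
    ← Real.rpow_natCast, ← Real.rpow_natCast, ← Real.rpow_natCast, ← Real.rpow_mul hJ.le,
    ← Real.rpow_mul hJ.le]
  have : ‖x.factor z‖ ^ (-(ξ + 2) * (2 : ℕ)) =
    (‖x.factor z‖ ^ ((4 : ℕ) : ℝ))⁻¹ * (‖x.factor z‖ ^ (((2 : ℕ) : ℝ) * ξ))⁻¹ := by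
    rw [← Real.rpow_neg hJ.le, ← Real.rpow_neg hJ.le, ← Real.rpow_add hJ]
    congr 1
    push_cast
    ring
  rw [this]
  ring

theorem eLpNorm_repFun {ξ : ℝ} (hξ : -1 < ξ) (x : UniversalCover) {f : ℂ → ℂ}
    (hf : DifferentiableOn ℂ f disc) :
    eLpNorm (repFun ξ x f) 2 (weightMeasure ξ) = eLpNorm f 2 (weightMeasure ξ) := by
  have h := lintegral_repFun hξ x f hf.continuousOn (differentiableOn_repFun x hf).continuousOn
  rw [eLpNorm_eq_lintegral_rpow_enorm_toReal two_ne_zero ENNReal.ofNat_ne_top,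
    eLpNorm_eq_lintegral_rpow_enorm_toReal two_ne_zero ENNReal.ofNat_ne_top]
  simp only [ENNReal.toReal_ofNat, ENNReal.rpow_ofNat]
  rw [h]

theorem repFun_mem {ξ : ℝ} (hξ : -1 < ξ) (x : UniversalCover) {f : ℂ → ℂ}
    (hf : f ∈ bergmanSubmodule ξ) : repFun ξ x f ∈ bergmanSubmodule ξ := by
  have hd := differentiableOn_repFun (ξ := ξ) x hf.1
  refine ⟨hd, fun z hz => indicator_of_notMem hz _, ?_, ?_⟩
  · have h1 : AEStronglyMeasurable (repFun ξ x f) (volume.restrict disc) :=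
      hd.continuousOn.aestronglyMeasurable measurableSet_ball
    exact h1.mono_ac (withDensity_absolutelyContinuous _ _)
  · rw [eLpNorm_repFun hξ x hf.1]
    exact hf.2.2.2

/-- The representation `π_ξ` of the universal covering group of `SU(1,1)` on `A²_ξ`, which is the
discrete series representation of `SU(1,1)` if `ξ` is an integer. Each `π_ξ(x)` preserves the
norm. -/
def rep (ξ : ℝ) [hξ : Fact (-1 < ξ)] (x : UniversalCover) : A2 ξ →ₗᵢ[ℂ] A2 ξ where
  toFun f := A2.mk (repFun ξ x f) (repFun_mem hξ.out x f.mem)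
  map_add' f g := A2.ext fun z hz => by
    rw [A2.coe_add]
    simp only [A2.mk_apply, repFun, indicator_of_mem hz, A2.coe_add]
    ring
  map_smul' c f := A2.ext fun z hz => by
    rw [RingHom.id_apply, A2.coe_smul]
    simp only [A2.mk_apply, repFun, indicator_of_mem hz, A2.coe_smul]
    ring
  norm_map' f := by
    rw [A2.norm_eq, A2.norm_eq]
    exact congrArg ENNReal.toReal (eLpNorm_repFun hξ.out x f.differentiableOn)

theorem rep_apply (x : UniversalCover) (f : A2 ξ) {z : ℂ} (hz : z ∈ disc) :
    rep ξ x f z = Complex.exp (-(ξ + 2) * x.logFactor z) * f (x.moebius z) := by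
  change repFun ξ x f z = _
  rw [repFun, indicator_of_mem hz]

/-- The space of smooth vectors of `π_ξ`: the vectors `v` for which `x ↦ π_ξ(x) v` is smooth. -/
def smoothVectors (ξ : ℝ) [Fact (-1 < ξ)] : Submodule ℂ (A2 ξ) where
  carrier := {v | ContDiff ℝ ∞ fun x : UniversalCover => rep ξ x v}
  zero_mem' := by
    simp only [mem_ofPred_eq, map_zero]
    exact contDiff_const
  add_mem' := fun {v w} hv hw => by
    simp only [mem_ofPred_eq, map_add] at hv hw ⊢
    exact hv.add hw
  smul_mem' := fun c v hv => by
    simp only [mem_ofPred_eq, map_smul] at hv ⊢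
    exact hv.const_smul c

/-- The Lie algebra `su(1,1)`, consisting of the matrices `[[ia, b], [b̄, -ia]]` with `a ∈ ℝ`
and `b ∈ ℂ`. -/
def su11 : Submodule ℝ (Matrix (Fin 2) (Fin 2) ℂ) where
  carrier := {X | ∃ (a : ℝ) (b : ℂ),
    X = !![Complex.I * a, b; conj b, -(Complex.I * a)]}
  zero_mem' := ⟨0, 0, by ext i j; fin_cases i <;> fin_cases j <;> simp⟩
  add_mem' := by
    rintro _ _ ⟨a, b, rfl⟩ ⟨c, d, rfl⟩
    refine ⟨a + c, b + d, ?_⟩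
    ext i j
    fin_cases i <;> fin_cases j <;> simp <;> ring
  smul_mem' := by
    rintro t _ ⟨a, b, rfl⟩
    refine ⟨t * a, t * b, ?_⟩
    ext i j
    fin_cases i <;> fin_cases j <;> simp <;> ring

/-- The lift `t ↦ exp(tX)` of the one-parameter subgroup of `SU(1,1)` generated by `X` to the
universal covering group: if `α(t)` is the upper left entry of the matrix `exp(tX)`, then the
coordinate `θ` is the continuous argument `Im ∫₀ᵗ α'(s)/α(s) ds` of `α(t)`. -/
def expLift (X : su11) (t : ℝ) : UniversalCover :=
  (∫ s in (0 : ℝ)..t,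
      (deriv (fun u : ℝ => NormedSpace.exp (u • (X : Matrix (Fin 2) (Fin 2) ℂ)) 0 0) s /
        NormedSpace.exp (s • (X : Matrix (Fin 2) (Fin 2) ℂ)) 0 0).im,
    NormedSpace.exp (t • (X : Matrix (Fin 2) (Fin 2) ℂ)) 0 1)

theorem hasDerivAt_exp_smul (X : Matrix (Fin 2) (Fin 2) ℂ) (i j : Fin 2) (t : ℝ) :
    HasDerivAt (fun u : ℝ => NormedSpace.exp (u • X) i j) ((X * NormedSpace.exp (t • X)) i j) t := by
  open scoped Matrix.Norms.Operator in
  exact hasDerivAt_pi.1 (hasDerivAt_pi.1 (hasDerivAt_exp_smul_const' (𝕂 := ℝ) X t) i) j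

theorem differentiableAt_expLift (X : su11) : DifferentiableAt ℝ (expLift X) 0 := by
  have hα := hasDerivAt_exp_smul X 0 0
  have hcont (i j : Fin 2) : Continuous fun u : ℝ =>
      NormedSpace.exp (u • (X : Matrix (Fin 2) (Fin 2) ℂ)) i j :=
    continuous_iff_continuousAt.2 fun t => (hasDerivAt_exp_smul X i j t).continuousAt
  refine DifferentiableAt.prodMk ?_ (hasDerivAt_exp_smul X 0 1 0).differentiableAt
  set U : Set ℝ := {s | NormedSpace.exp (s • (X : Matrix (Fin 2) (Fin 2) ℂ)) 0 0 ≠ 0}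
  have hU : IsOpen U := isOpen_ne_fun (hcont 0 0) continuous_const
  have h0 : (0 : ℝ) ∈ U := by simp [U, NormedSpace.exp_zero]
  have hc : ContinuousOn (fun s : ℝ =>
      (deriv (fun u : ℝ => NormedSpace.exp (u • (X : Matrix (Fin 2) (Fin 2) ℂ)) 0 0) s /
        NormedSpace.exp (s • (X : Matrix (Fin 2) (Fin 2) ℂ)) 0 0).im) U := by
    refine Complex.continuous_im.comp_continuousOn (ContinuousOn.div ?_ (hcont 0 0).continuousOn
      fun s hs => hs)
    rw [funext fun s => (hα s).deriv]
    simp only [Matrix.mul_apply, Fin.sum_univ_two]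
    exact ((continuous_const.mul (hcont 0 0)).add
      (continuous_const.mul (hcont 1 0))).continuousOn
  exact (intervalIntegral.integral_hasDerivAt_right IntervalIntegrable.refl
    (hc.stronglyMeasurableAtFilter hU 0 h0)
    (hc.continuousAt (hU.mem_nhds h0))).differentiableAt

theorem expLift_zero (X : su11) : expLift X 0 = 0 := by
  simp [expLift, NormedSpace.exp_zero]

theorem differentiableAt_rep_expLift (X : su11) {v : A2 ξ} (hv : v ∈ smoothVectors ξ) :
    DifferentiableAt ℝ (fun t : ℝ => rep ξ (expLift X t) v) 0 :=
  DifferentiableAt.comp (g := fun x => rep ξ x v) 0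
    ((show ContDiff ℝ ∞ fun x : UniversalCover => rep ξ x v from hv).differentiable
      (by simp) _) (differentiableAt_expLift X)

/-- The operator `π_ξ(X)` for `X ∈ su(1,1)`: the derivative of `t ↦ π_ξ(exp(tX)) v` at `t = 0`,
with the smooth vectors as its domain. -/
def derivedRep (ξ : ℝ) [Fact (-1 < ξ)] (X : su11) : A2 ξ →ₗ.[ℂ] A2 ξ where
  domain := smoothVectors ξ
  toFun :=
    { toFun := fun v => deriv (fun t : ℝ => rep ξ (expLift X t) (v : A2 ξ)) 0
      map_add' := fun v w => by
        simp only [Submodule.coe_add, map_add]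
        exact deriv_add (differentiableAt_rep_expLift X v.2) (differentiableAt_rep_expLift X w.2)
      map_smul' := fun c v => by
        simp only [Submodule.coe_smul, map_smul, RingHom.id_apply]
        exact deriv_const_smul c (differentiableAt_rep_expLift X v.2) }

/-- The closure `Π_ξ(X)` of `π_ξ(X)`. -/
def derivedRepClosure (ξ : ℝ) [Fact (-1 < ξ)] (X : su11) : A2 ξ →ₗ.[ℂ] A2 ξ :=
  (derivedRep ξ X).closure

/-- The operator `i T + d`, with the domain of `T`. -/
def iMulAdd {ξ : ℝ} [Fact (-1 < ξ)] (T : A2 ξ →ₗ.[ℂ] A2 ξ) (d : ℝ) : A2 ξ →ₗ.[ℂ] A2 ξ :=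
  ((d : ℂ) • LinearMap.id (R := ℂ) (M := A2 ξ)) +ᵥ (Complex.I • T)

/-- `expLift X` lies above the one-parameter subgroup `t ↦ exp(tX)` of `SU(1,1)`. -/
theorem toSU_expLift (X : su11) (t : ℝ) :
    (expLift X t).toSU = NormedSpace.exp (t • (X : Matrix (Fin 2) (Fin 2) ℂ)) := by
  obtain ⟨a, b, hX⟩ := X.2
  set E : ℝ → Matrix (Fin 2) (Fin 2) ℂ :=
    fun t => NormedSpace.exp (t • (X : Matrix (Fin 2) (Fin 2) ℂ)) with hE
  have hE0 : E 0 = 1 := by simp [hE, NormedSpace.exp_zero]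
  have hd (i j : Fin 2) (t : ℝ) : HasDerivAt (fun u => E u i j) ((X.1 * E t) i j) t :=
    hasDerivAt_exp_smul X.1 i j t
  have hd00 (t : ℝ) : HasDerivAt (fun u => E u 0 0) (Complex.I * a * E t 0 0 + b * E t 1 0) t := by
    simpa [hX, Matrix.mul_apply] using hd 0 0 t
  have hd01 (t : ℝ) : HasDerivAt (fun u => E u 0 1) (Complex.I * a * E t 0 1 + b * E t 1 1) t := by
    simpa [hX, Matrix.mul_apply] using hd 0 1 t
  have hd10 (t : ℝ) :
      HasDerivAt (fun u => E u 1 0) (conj b * E t 0 0 - Complex.I * a * E t 1 0) t := by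
    simpa [hX, Matrix.mul_apply, sub_eq_add_neg] using hd 1 0 t
  have hd11 (t : ℝ) :
      HasDerivAt (fun u => E u 1 1) (conj b * E t 0 1 - Complex.I * a * E t 1 1) t := by
    simpa [hX, Matrix.mul_apply, sub_eq_add_neg] using hd 1 1 t
  have const (F : ℝ → ℂ) (hF : ∀ t, HasDerivAt F 0 t) (t : ℝ) : F t = F 0 :=
    is_const_of_deriv_eq_zero (fun t => (hF t).differentiableAt) (fun t => (hF t).deriv) t 0
  have p1 (t : ℝ) : E t 0 0 * conj (E t 0 0) - E t 1 0 * conj (E t 1 0) = 1 := by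
    have := const (fun t => E t 0 0 * conj (E t 0 0) - E t 1 0 * conj (E t 1 0)) (fun t => by
      refine (((hd00 t).mul (hd00 t).star).sub ((hd10 t).mul (hd10 t).star)).congr_deriv ?_
      simp
      ring) t
    simpa [hE0] using this
  have p2 (t : ℝ) : conj (E t 0 0) * E t 0 1 - conj (E t 1 0) * E t 1 1 = 0 := by
    have := const (fun t => conj (E t 0 0) * E t 0 1 - conj (E t 1 0) * E t 1 1) (fun t => by
      refine (((hd00 t).star.mul (hd01 t)).sub ((hd10 t).star.mul (hd11 t))).congr_deriv ?_
      simp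
      ring) t
    simpa [hE0] using this
  have p3 (t : ℝ) : E t 0 0 * E t 1 1 - E t 0 1 * E t 1 0 = 1 := by
    have := const (fun t => E t 0 0 * E t 1 1 - E t 0 1 * E t 1 0) (fun t => by
      refine (((hd00 t).mul (hd11 t)).sub ((hd01 t).mul (hd10 t))).congr_deriv ?_
      ring) t
    simpa [hE0] using this
  have h11 : E t 1 1 = conj (E t 0 0) := by
    linear_combination -E t 1 1 * p1 t + E t 1 0 * p2 t + conj (E t 0 0) * p3 t
  have h10 : E t 1 0 = conj (E t 0 1) := by
    have : E t 0 1 = conj (E t 1 0) := by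
      linear_combination -E t 0 1 * p1 t + E t 0 0 * p2 t + conj (E t 1 0) * p3 t
    rw [this, Complex.conj_conj]
  have hne (t : ℝ) : E t 0 0 ≠ 0 := fun h => by
    have := p1 t
    rw [h, zero_mul, zero_sub, Complex.mul_conj'] at this
    have h' : -(‖E t 1 0‖ ^ 2) = (1 : ℝ) := by exact_mod_cast this
    nlinarith [sq_nonneg ‖E t 1 0‖]
  have hcont (i j : Fin 2) : Continuous fun u => E u i j :=
    continuous_iff_continuousAt.2 fun t => (hd i j t).continuousAt
  set q : ℝ → ℂ := fun s => deriv (fun u => E u 0 0) s / E s 0 0 with hq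
  have hqc : Continuous q := by
    refine Continuous.div ?_ (hcont 0 0) hne
    rw [funext fun s => (hd00 s).deriv]
    exact (continuous_const.mul (hcont 0 0)).add (continuous_const.mul (hcont 1 0))
  have hexp : E t 0 0 = Complex.exp (∫ s in (0 : ℝ)..t, q s) := by
    have hder (t : ℝ) : HasDerivAt (fun t => ∫ s in (0 : ℝ)..t, q s) (q t) t :=
      intervalIntegral.integral_hasDerivAt_right (hqc.intervalIntegrable _ _)
        (hqc.stronglyMeasurableAtFilter _ _) hqc.continuousAt
    have := const (fun t => E t 0 0 * Complex.exp (-∫ s in (0 : ℝ)..t, q s)) (fun t => by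
      refine ((hd00 t).mul (hder t).neg.cexp).congr_deriv ?_
      simp only [hq, (hd00 t).deriv]
      field_simp [hne t]
      ring) t
    simp only [hE0, intervalIntegral.integral_same, neg_zero, Complex.exp_zero, mul_one,
      Matrix.one_apply_eq] at this
    rw [Complex.exp_neg] at this
    field_simp at this
    exact this
  have him : (∫ s in (0 : ℝ)..t, (q s).im) = (∫ s in (0 : ℝ)..t, q s).im :=
    Complex.imCLM.intervalIntegral_comp_comm (hqc.intervalIntegrable _ _)
  have hlift : expLift X t = ((∫ s in (0 : ℝ)..t, q s).im, E t 0 1) := by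
    rw [← him]
    rfl
  have hnorm : √(1 + ‖E t 0 1‖ ^ 2) = ‖E t 0 0‖ := by
    rw [Real.sqrt_eq_iff_eq_sq (by positivity) (norm_nonneg _)]
    have := p1 t
    rw [h10, Complex.mul_conj', Complex.conj_conj, Complex.conj_mul'] at this
    have h' : ‖E t 0 0‖ ^ 2 - ‖E t 0 1‖ ^ 2 = (1 : ℝ) := by exact_mod_cast this
    linarith
  have halpha : (expLift X t).alpha = E t 0 0 := by
    rw [UniversalCover.alpha, hlift]
    simp only
    rw [hnorm, hexp, Complex.norm_exp, Complex.ofReal_exp, ← Complex.exp_add,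
      Complex.re_add_im]
  have hbeta : (expLift X t).beta = E t 0 1 := rfl
  rw [UniversalCover.toSU, halpha, hbeta, ← h11, ← h10]
  exact (Matrix.eta_fin_two (E t)).symm

end Bergman

end

/-! On monomials the operator of part (1) is tridiagonal: `L zⁿ = c(n+ξ+2) zⁿ⁺¹ + (an+b) zⁿ + c̄ n
zⁿ⁻¹`. The proof plays this Jacobi matrix against the unitary representation.

The representation gives symmetry. Each `π_ξ(x)` is an isometry, so `π_ξ(X)` is skew-symmetric on
smooth vectors (`inner_derivedRep`). Polynomials are smooth vectors (`mono_mem_smoothVectors`), and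
differentiating the formula for `π_ξ(exp(tX))` pointwise at `t = 0` shows that `L` is a restriction
of `iπ_ξ(X) + d` (`diffOp_le_iMulAdd`). No integral over the disc is computed: rotations make the
monomials orthogonal, Riesz representation of the Taylor functionals makes them total, and
skew-symmetry yields the ratio of the norms of `zⁿ⁺¹` and `zⁿ`.

The Jacobi matrix gives self-adjointness. In the normalized monomials its off-diagonal entries grow
at most linearly, which is within Carleman's condition. Concretely, if `(u, w)` lies in the graph of
`L*`, then `L` applied to the Fejér means of `u` differs from the Fejér means of `w` by a commutator
that tends to `0`; so `(u, w)` is a limit of points of the graph of `L`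
(`mem_topologicalClosure_of_jacobi`). Hence the closure of `L` is `L*`. The symmetric operator
`iπ_ξ(X) + d` lies between `L` and `L*`, so it has the same closure.

For part (2), `f d/dz + g` with holomorphic `f`, `g` lowers degrees by at most one, so a symmetric
one raises them by at most one as well. Comparing matrix entries then determines all Taylor
coefficients of `f` and `g` (`exists_eq_of_isFormalAdjoint`), and part (1) applies. -/

noncomputable section

namespace Bergman

open MeasureTheory Metric Set Filter Topology
open scoped ComplexConjugate ENNReal ContDiff

/-! ### Evaluation, monomials and the shift -/

section Basis

variable {ξ : ℝ} [hξ : Fact (-1 < ξ)]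

/-- Evaluation at a point, as a continuous linear functional on `A²_ξ`. -/
def evalCLM (ξ : ℝ) [Fact (-1 < ξ)] (z : ℂ) : A2 ξ →L[ℂ] ℂ :=
  LinearMap.mkContinuousOfExistsBound
    { toFun := fun f => f z
      map_add' := fun _ _ => rfl
      map_smul' := fun _ _ => rfl } <| by
    by_cases hz : z ∈ disc
    · obtain ⟨C, hC⟩ := exists_pointwise_bound (ξ := ξ) (r := ‖z‖) (by simpa using hz)
      exact ⟨C, fun f => hC f z (by simp)⟩
    · refine ⟨0, fun f => ?_⟩
      change ‖f z‖ ≤ _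
      rw [f.mem.2.1 z hz]
      simp

theorem evalCLM_apply (z : ℂ) (f : A2 ξ) : evalCLM ξ z f = f z := rfl

theorem ofPoly_apply (p : Polynomial ℂ) {z : ℂ} (hz : z ∈ disc) :
    ofPoly ξ p z = p.eval z := by
  rw [ofPoly, A2.mk_apply, indicator_of_mem hz]

/-- The monomial `z ^ n` as an element of `A²_ξ`. -/
def mono (ξ : ℝ) [Fact (-1 < ξ)] (n : ℕ) : A2 ξ := ofPoly ξ (Polynomial.X ^ n)

theorem mono_apply (n : ℕ) {z : ℂ} (hz : z ∈ disc) : mono ξ n z = z ^ n := by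
  rw [mono, ofPoly_apply _ hz]
  simp

theorem mono_mem (n : ℕ) : mono ξ n ∈ polySubmodule ξ :=
  ⟨Polynomial.X ^ n, fun _ hz => ofPoly_apply _ hz⟩

theorem polySubmodule_eq_span : polySubmodule ξ = Submodule.span ℂ (range (mono ξ)) := by
  refine le_antisymm ?_ (Submodule.span_le.2 ?_)
  · rintro h ⟨p, hp⟩
    have : h = p.sum fun n c => c • mono ξ n := by
      refine A2.ext fun z hz => ?_
      rw [hp z hz, ← evalCLM_apply z (p.sum _), Polynomial.sum, map_sum, Polynomial.eval_eq_sum,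
        Polynomial.sum]
      refine Finset.sum_congr rfl fun n _ => ?_
      rw [evalCLM_apply, A2.coe_smul, mono_apply n hz]
    rw [this]
    exact Submodule.sum_mem _ fun n _ =>
      Submodule.smul_mem _ _ (Submodule.subset_span (mem_range_self n))
  · rintro _ ⟨n, rfl⟩
    exact mono_mem n

theorem mono_ne_zero (n : ℕ) : mono ξ n ≠ 0 := fun h => by
  have hz : (1 / 2 : ℂ) ∈ disc := by norm_num [disc]
  have h1 := mono_apply (ξ := ξ) n hz
  rw [h] at h1
  exact pow_ne_zero n (by norm_num : (1 / 2 : ℂ) ≠ 0) h1.symm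

/-- Multiplication by `z` on `A²_ξ`. -/
def shift (ξ : ℝ) [Fact (-1 < ξ)] : A2 ξ →L[ℂ] A2 ξ :=
  LinearMap.mkContinuous
    { toFun := fun f => A2.mk (fun z => z * f z) (by
        simpa using polynomial_mul_mem Polynomial.X f.mem)
      map_add' := fun f g => A2.ext fun z _ => mul_add z (f z) (g z)
      map_smul' := fun c f => A2.ext fun z _ => mul_left_comm z c (f z) } 1 <| fun f => by
    rw [one_mul, A2.norm_eq, A2.norm_eq]
    refine ENNReal.toReal_mono f.memLp.2.ne (eLpNorm_mono fun z => ?_)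
    change ‖z * f z‖ ≤ ‖f z‖
    rw [norm_mul]
    by_cases hz : z ∈ disc
    · have : ‖z‖ < 1 := by simpa using hz
      exact mul_le_of_le_one_left (norm_nonneg _) this.le
    · simp [f.mem.2.1 z hz]

theorem shift_apply (f : A2 ξ) (z : ℂ) : shift ξ f z = z * f z := rfl

theorem norm_shift_le (f : A2 ξ) : ‖shift ξ f‖ ≤ ‖f‖ := by
  simpa using (shift ξ).le_of_opNorm_le (LinearMap.mkContinuous_norm_le _ zero_le_one _) f

theorem shift_pow_apply (n : ℕ) (f : A2 ξ) (z : ℂ) : (shift ξ ^ n) f z = z ^ n * f z := by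
  induction n with
  | zero => simp
  | succ n ih =>
    rw [pow_succ', mul_apply_eq_comp, shift_apply, ih]
    ring

theorem shift_mono (n : ℕ) : shift ξ (mono ξ n) = mono ξ (n + 1) := A2.ext fun z hz => by
  rw [shift_apply, mono_apply n hz, mono_apply _ hz]
  ring

theorem shift_pow_mono (n k : ℕ) : (shift ξ ^ n) (mono ξ k) = mono ξ (n + k) :=
  A2.ext fun z hz => by
    rw [shift_pow_apply, mono_apply k hz, mono_apply _ hz]
    ring

/-- Multiplication by `z` is a contraction. This monotonicity is all that the growth bound on the
matrix entries needs from the norms. -/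
theorem norm_mono_succ_le (n : ℕ) : ‖mono ξ (n + 1)‖ ≤ ‖mono ξ n‖ := by
  rw [← shift_mono]
  exact norm_shift_le _

theorem norm_mono_le (n : ℕ) : ‖mono ξ n‖ ≤ ‖mono ξ 0‖ :=
  antitone_nat_of_succ_le (f := fun n => ‖mono ξ n‖) norm_mono_succ_le (Nat.zero_le n)

/-- The `n`-th derivative at `0`, as a continuous linear functional on `A²_ξ`. -/
def derivCLM (ξ : ℝ) [Fact (-1 < ξ)] (n : ℕ) : A2 ξ →L[ℂ] ℂ :=
  LinearMap.mkContinuousOfExistsBound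
    { toFun := fun f => iteratedDeriv n f 0
      map_add' := fun f g => iteratedDeriv_add
        ((f.differentiableOn.contDiffOn isOpen_ball).contDiffAt (isOpen_ball.mem_nhds (by simp)))
        ((g.differentiableOn.contDiffOn isOpen_ball).contDiffAt (isOpen_ball.mem_nhds (by simp)))
      map_smul' := fun c f => iteratedDeriv_const_mul_field c f } <| by
    obtain ⟨C, hC⟩ := exists_pointwise_bound (ξ := ξ) (r := 1 / 2) (by norm_num)
    -- Cauchy's estimate on the circle of radius `1/2`, where `|f| ≤ C‖f‖`.
    refine ⟨n.factorial * C / (1 / 2) ^ n, fun f => ?_⟩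
    refine (Complex.norm_iteratedDeriv_le_of_forall_mem_sphere_norm_le (R := 1 / 2)
      (C := C * ‖f‖) n (by norm_num) ?_ fun z hz => hC f z (sphere_subset_closedBall hz)).trans
      (le_of_eq (by ring))
    refine (f.differentiableOn.mono ?_).diffContOnCl
    rw [closure_ball _ (by norm_num)]
    exact closedBall_subset_ball (by norm_num)

theorem hasSum_derivCLM (f : A2 ξ) {z : ℂ} (hz : z ∈ disc) :
    HasSum (fun n : ℕ => (n.factorial : ℂ)⁻¹ * (z ^ n * derivCLM ξ n f)) (f z) := by
  simpa using! Complex.hasSum_taylorSeries_on_ball f.differentiableOn hz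

theorem eq_zero_of_derivCLM {f : A2 ξ} (h : ∀ n, derivCLM ξ n f = 0) : f = 0 :=
  A2.ext fun z hz => by
    have := hasSum_derivCLM f hz
    simp only [h, mul_zero] at this
    exact this.unique hasSum_zero

/-! ### Rotations and the orthonormal basis -/

/-- The action of the rotation by the angle `θ`. -/
def rot (ξ : ℝ) [Fact (-1 < ξ)] (θ : ℝ) : A2 ξ →ₗᵢ[ℂ] A2 ξ := rep ξ (θ, 0)

/-- The eigenvalue of a rotation on `z ^ n`. -/
def rotEigenvalue (ξ θ : ℝ) (n : ℕ) : ℂ :=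
  Complex.exp (((-(ξ + 2) * θ - 2 * n * θ : ℝ) : ℂ) * Complex.I)

theorem norm_rotEigenvalue (ξ θ : ℝ) (n : ℕ) : ‖rotEigenvalue ξ θ n‖ = 1 :=
  Complex.norm_exp_ofReal_mul_I _

theorem conj_mul_rotEigenvalue (ξ θ : ℝ) (n m : ℕ) :
    conj (rotEigenvalue ξ θ n) * rotEigenvalue ξ θ m =
      Complex.exp (((2 * (n - m) * θ : ℝ) : ℂ) * Complex.I) := by
  rw [rotEigenvalue, rotEigenvalue, ← Complex.exp_conj, ← Complex.exp_add]
  congr 1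
  simp only [map_mul, Complex.conj_I, Complex.conj_ofReal]
  push_cast
  ring

/-- At the angle `π / (2(n - m))` the two eigenvalues are opposite. A single such rotation separates
`zⁿ` from `zᵐ`, without averaging over the circle. -/
theorem exists_rotEigenvalue_neg {n m : ℕ} (h : n ≠ m) (ξ : ℝ) :
    ∃ θ : ℝ, conj (rotEigenvalue ξ θ n) * rotEigenvalue ξ θ m = -1 := by
  refine ⟨Real.pi / (2 * (n - m)), ?_⟩
  have h' : (n : ℝ) - m ≠ 0 := sub_ne_zero.2 (by exact_mod_cast h)
  rw [conj_mul_rotEigenvalue, show 2 * ((n : ℝ) - m) * (Real.pi / (2 * (n - m))) = Real.pi by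
    field_simp, Complex.exp_pi_mul_I]

theorem rot_apply (θ : ℝ) (f : A2 ξ) {z : ℂ} (hz : z ∈ disc) :
    rot ξ θ f z = rotEigenvalue ξ θ 0 * f (Complex.exp ((-2 * θ : ℝ) * Complex.I) * z) := by
  have h1 : Complex.exp (-(2 * θ * Complex.I)) =
      Complex.exp (-(θ * Complex.I)) / Complex.exp (θ * Complex.I) := by
    rw [← Complex.exp_sub]
    ring_nf
  rw [rot, rep_apply _ _ hz]
  congr 2
  · simp [UniversalCover.logFactor, UniversalCover.beta]
    ring
  · simp [UniversalCover.moebius, UniversalCover.factor, UniversalCover.alpha,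
      UniversalCover.beta, ← Complex.exp_conj, h1]
    field_simp

theorem rot_mono (θ : ℝ) (n : ℕ) : rot ξ θ (mono ξ n) = rotEigenvalue ξ θ n • mono ξ n :=
  A2.ext fun z hz => by
    have hz' : Complex.exp ((-2 * θ : ℝ) * Complex.I) * z ∈ disc := by
      rw [mem_ball_zero_iff, norm_mul, Complex.norm_exp_ofReal_mul_I, one_mul]
      exact mem_ball_zero_iff.1 hz
    rw [rot_apply θ _ hz, mono_apply n hz', A2.coe_smul, mono_apply n hz, mul_pow,
      ← Complex.exp_nat_mul, ← mul_assoc, rotEigenvalue, rotEigenvalue, ← Complex.exp_add]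
    congr 2
    push_cast
    ring

theorem derivCLM_rot (θ : ℝ) (n : ℕ) (f : A2 ξ) :
    derivCLM ξ n (rot ξ θ f) = rotEigenvalue ξ θ n * derivCLM ξ n f := by
  set c := Complex.exp ((-2 * θ : ℝ) * Complex.I) with hc
  have hc1 : ‖c‖ = 1 := Complex.norm_exp_ofReal_mul_I _
  have h0 : (0 : ℂ) ∈ disc := by simp
  -- Elements of `A²_ξ` vanish off the disc and the formula for `rot` holds only on it, so the
  -- derivatives are compared within the disc.
  have hW (g : ℂ → ℂ) : iteratedDerivWithin n g disc 0 = iteratedDeriv n g 0 :=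
    iteratedDerivWithin_of_isOpen isOpen_ball h0
  have h1 : iteratedDeriv n (rot ξ θ f) 0 =
      iteratedDeriv n (fun z => rotEigenvalue ξ θ 0 * f (c * z)) 0 := by
    rw [← hW, ← hW]
    exact iteratedDerivWithin_congr (fun z hz => rot_apply θ f hz) h0
  have h2 : iteratedDeriv n (fun z => f (c * z)) 0 = c ^ n * iteratedDeriv n f 0 := by
    have := iteratedDerivWithin_comp_const_smul (n := n) (s := disc) (f := f) h0
      isOpen_ball.uniqueDiffOn (f.differentiableOn.contDiffOn isOpen_ball) c
      (fun z hz => by simpa [hc1] using hz)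
    rw [hW, mul_zero, hW] at this
    exact this
  change iteratedDeriv n (rot ξ θ f) 0 = _ * iteratedDeriv n f 0
  rw [h1, iteratedDeriv_const_mul_field, h2, ← mul_assoc, hc, ← Complex.exp_nat_mul,
    rotEigenvalue, rotEigenvalue, ← Complex.exp_add]
  congr 2
  push_cast
  ring

/-- A rotation preserves the inner product and, at the angle chosen, multiplies it by `-1`. -/
theorem inner_mono {n m : ℕ} (h : n ≠ m) : inner ℂ (mono ξ n) (mono ξ m) = 0 := by
  obtain ⟨θ, hθ⟩ := exists_rotEigenvalue_neg h ξ
  have h1 := (rot ξ θ).inner_map_map (mono ξ n) (mono ξ m)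
  rw [rot_mono, rot_mono, inner_smul_left, inner_smul_right, ← mul_assoc, hθ] at h1
  linear_combination (-1 / 2 : ℂ) * h1

/-- A vector representing the `n`-th Taylor functional inherits its behaviour under rotations: it is
an eigenvector with the eigenvalue of `zⁿ`. Its other Taylor coefficients transform by different
eigenvalues for a suitable angle, hence vanish. -/
theorem exists_smul_mono_of_inner_eq {n : ℕ} {k : A2 ξ}
    (hk : ∀ f, inner ℂ k f = derivCLM ξ n f) : ∃ C : ℂ, k = C • mono ξ n := by
  have hrot (θ : ℝ) : rot ξ θ k = rotEigenvalue ξ θ n • k := by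
    set μ := rotEigenvalue ξ θ n
    have hμ : conj μ * μ = 1 := by
      rw [Complex.conj_mul', norm_rotEigenvalue]
      simp
    have h1 : inner ℂ (μ • k) (rot ξ θ k) = inner ℂ k k := by
      rw [inner_smul_left, hk, derivCLM_rot, ← hk, ← mul_assoc, hμ, one_mul]
    have h2 : inner ℂ (rot ξ θ k) (μ • k) = inner ℂ k k := by
      rw [← inner_conj_symm, h1, inner_self_conj]
    -- All four terms of the expansion of `‖rot k - μ k‖²` are equal up to sign to `⟨k, k⟩`, and
    -- they cancel.
    rw [← sub_eq_zero, ← inner_self_eq_zero (𝕜 := ℂ), inner_sub_left, inner_sub_right,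
      inner_sub_right, h1, h2, (rot ξ θ).inner_map_map, inner_smul_left, inner_smul_right,
      ← mul_assoc, hμ]
    ring
  have h0 (m : ℕ) (hm : n ≠ m) : derivCLM ξ m k = 0 := by
    obtain ⟨θ, hθ⟩ := exists_rotEigenvalue_neg hm ξ
    have h1 := derivCLM_rot θ m k
    rw [hrot θ, map_smul, smul_eq_mul] at h1
    have h2 : conj (rotEigenvalue ξ θ n) * rotEigenvalue ξ θ n = 1 := by
      rw [Complex.conj_mul', norm_rotEigenvalue]
      simp
    linear_combination (1 / 2 : ℂ) * (conj (rotEigenvalue ξ θ n) * h1 - derivCLM ξ m k * h2 +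
      derivCLM ξ m k * hθ)
  refine ⟨(n.factorial : ℂ)⁻¹ * derivCLM ξ n k, A2.ext fun z hz => ?_⟩
  have h1 := hasSum_derivCLM k hz
  have h2 := hasSum_single (f := fun m : ℕ => (m.factorial : ℂ)⁻¹ * (z ^ m * derivCLM ξ m k)) n
    fun m hm => by rw [h0 m hm.symm]; simp
  rw [h1.unique h2, A2.coe_smul, mono_apply n hz]
  ring

/-- By Riesz, each Taylor functional is the inner product with a multiple of a monomial. A vector
orthogonal to all monomials therefore has zero Taylor series. This gives totality without norm
convergence of Taylor series. -/
theorem eq_zero_of_inner_mono {f : A2 ξ} (h : ∀ n, inner ℂ (mono ξ n) f = 0) : f = 0 := by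
  refine eq_zero_of_derivCLM fun n => ?_
  have hk (g : A2 ξ) : inner ℂ ((InnerProductSpace.toDual ℂ (A2 ξ)).symm (derivCLM ξ n)) g =
      derivCLM ξ n g := InnerProductSpace.toDual_symm_apply
  obtain ⟨C, hC⟩ := exists_smul_mono_of_inner_eq hk
  rw [← hk f, hC, inner_smul_left, h n, mul_zero]

/-- The normalized monomials. -/
def onb (ξ : ℝ) [Fact (-1 < ξ)] (n : ℕ) : A2 ξ := (‖mono ξ n‖⁻¹ : ℂ) • mono ξ n

theorem norm_mono_pos (n : ℕ) : 0 < ‖mono ξ n‖ := norm_pos_iff.2 (mono_ne_zero n)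

theorem norm_mono_ne (n : ℕ) : (‖mono ξ n‖ : ℂ) ≠ 0 :=
  Complex.ofReal_ne_zero.2 (norm_mono_pos n).ne'

theorem mono_eq_smul_onb (n : ℕ) : mono ξ n = (‖mono ξ n‖ : ℂ) • onb ξ n := by
  rw [onb, smul_smul, mul_inv_cancel₀ (norm_mono_ne n), one_smul]

theorem onb_mem (n : ℕ) : onb ξ n ∈ polySubmodule ξ :=
  (polySubmodule ξ).smul_mem _ (mono_mem n)

theorem orthonormal_onb : Orthonormal ℂ (onb ξ) := by
  refine ⟨fun n => ?_, fun n m h => ?_⟩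
  · rw [onb, norm_smul, norm_inv, Complex.norm_real, norm_norm,
      inv_mul_cancel₀ (norm_mono_pos n).ne']
  · simp only [onb]
    rw [inner_smul_left, inner_smul_right, inner_mono h]
    simp

/-- The normalized monomials form a Hilbert basis. -/
def onbBasis (ξ : ℝ) [Fact (-1 < ξ)] : HilbertBasis ℕ ℂ (A2 ξ) :=
  HilbertBasis.mkOfOrthogonalEqBot orthonormal_onb <| by
    refine (Submodule.eq_bot_iff _).2 fun f hf => eq_zero_of_inner_mono fun n => ?_
    have := (Submodule.mem_orthogonal _ f).1 hf _ (Submodule.subset_span (mem_range_self n))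
    rw [mono_eq_smul_onb, inner_smul_left, this, mul_zero]

theorem coe_onbBasis : ⇑(onbBasis ξ) = onb ξ := HilbertBasis.coe_mkOfOrthogonalEqBot _ _

theorem dense_polySubmodule : Dense (polySubmodule ξ : Set (A2 ξ)) := by
  rw [Submodule.dense_iff_topologicalClosure_eq_top, Submodule.topologicalClosure_eq_top_iff,
    Submodule.eq_bot_iff]
  exact fun f hf => eq_zero_of_inner_mono fun n =>
    (Submodule.mem_orthogonal _ f).1 hf _ (mono_mem n)

end Basis

section Smooth

variable {ξ : ℝ} [hξ : Fact (-1 < ξ)]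

/-! ### Polynomials are smooth vectors -/

/-- The dilates `z ↦ g (w z)` of a holomorphic function on the disc depend holomorphically
on `w` as elements of `A²_ξ`. -/
theorem exists_differentiableOn_dilate (ξ : ℝ) [Fact (-1 < ξ)] {g : ℂ → ℂ}
    (hg : DifferentiableOn ℂ g disc) :
    ∃ Ψ : ℂ → A2 ξ, DifferentiableOn ℂ Ψ disc ∧ ∀ w ∈ disc, ∀ z ∈ disc, Ψ w z = g (w * z) := by
  set c : ℕ → ℂ := fun n => (n.factorial : ℂ)⁻¹ * iteratedDeriv n g 0 with hc
  have hsum {z : ℂ} (hz : z ∈ disc) : HasSum (fun n => c n * z ^ n) (g z) := by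
    refine (Complex.hasSum_taylorSeries_on_ball hg hz).congr_fun fun n => ?_
    simp only [hc, sub_zero, smul_eq_mul]
    ring
  set F : ℕ → ℂ → A2 ξ := fun n w => (c n * w ^ n) • mono ξ n with hF
  -- Weierstrass test for `∑ cₙ wⁿ zⁿ` in `A²_ξ` on `|w| ≤ r`: the Taylor series of `g` converges
  -- absolutely at `r`, and `‖zⁿ‖ ≤ ‖1‖`.
  have hbound {r : ℝ} (hr0 : 0 ≤ r) (hr : r < 1) :
      Summable fun n => ‖c n‖ * r ^ n * ‖mono ξ 0‖ := by
    have hz : (r : ℂ) ∈ disc := by simpa [abs_of_nonneg hr0] using hr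
    refine ((hsum hz).summable.norm.mul_right ‖mono ξ 0‖).congr fun n => ?_
    rw [norm_mul, norm_pow, Complex.norm_real, Real.norm_of_nonneg hr0]
  have hle {r : ℝ} (n : ℕ) {w : ℂ} (hw : ‖w‖ ≤ r) :
      ‖F n w‖ ≤ ‖c n‖ * r ^ n * ‖mono ξ 0‖ := by
    rw [hF, norm_smul, norm_mul, norm_pow]
    have h1 := norm_mono_le (ξ := ξ) n
    have h2 := (norm_nonneg w).trans hw
    gcongr
  refine ⟨fun w => ∑' n, F n w, fun w hw => ?_, fun w hw z hz => ?_⟩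
  · obtain ⟨r, hwr, hr⟩ := exists_between (mem_ball_zero_iff.1 hw)
    have h := Complex.differentiableOn_tsum_of_summable_norm (F := F) (U := ball 0 r)
      (hbound ((norm_nonneg _).trans hwr.le) hr) (fun n => by
        refine DifferentiableOn.smul_const ?_ _
        fun_prop) isOpen_ball
      fun n w hw => hle n (mem_ball_zero_iff.1 hw).le
    exact (h.differentiableAt (isOpen_ball.mem_nhds
      (mem_ball_zero_iff.2 hwr))).differentiableWithinAt
  · have h1 : Summable fun n => F n w :=
      .of_norm_bounded (hbound (norm_nonneg _) (mem_ball_zero_iff.1 hw)) fun n => hle n le_rfl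
    have h2 := (h1.hasSum).mapL (evalCLM ξ z)
    have hwz : w * z ∈ disc := by
      rw [mem_ball_zero_iff, norm_mul]
      exact mul_lt_one_of_nonneg_of_lt_one_left (norm_nonneg _) (mem_ball_zero_iff.1 hw)
        (mem_ball_zero_iff.1 hz).le
    refine h2.unique ((hsum hwz).congr_fun fun n => ?_)
    rw [evalCLM_apply, hF, A2.coe_smul, mono_apply n hz, mul_pow]
    ring

theorem contDiff_norm_factor : ContDiff ℝ ∞ fun x : UniversalCover => √(1 + ‖x.2‖ ^ 2) :=
  (contDiff_const.add (contDiff_snd.norm_sq ℝ)).sqrt fun x => by positivity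

theorem contDiff_alpha : ContDiff ℝ ∞ UniversalCover.alpha := by
  refine (Complex.ofRealCLM.contDiff.comp contDiff_norm_factor).mul ?_
  exact ((Complex.ofRealCLM.contDiff.comp contDiff_fst).mul contDiff_const).cexp

theorem contDiff_conj_comp {E : Type*} [NormedAddCommGroup E] [NormedSpace ℝ E] {f : E → ℂ}
    (hf : ContDiff ℝ ∞ f) : ContDiff ℝ ∞ fun x => conj (f x) :=
  (Complex.conjCLE.contDiff (𝕜 := ℝ)).comp hf

theorem contDiff_beta : ContDiff ℝ ∞ UniversalCover.beta := contDiff_snd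

/-- With `w = β̄/α` one has `-β̄z + α = α(1 - wz)`, so `π_ξ(x) zⁿ` is `s(x) (ᾱz - β)ⁿ g(wz)` with
`g(t) = (1 - t)^(-(ξ+2)-n)`. The scalar `s` is smooth, the dilate of `g` depends holomorphically on
`w` in the disc, and the power is an iterated application of bounded operators with smooth
coefficients. -/
theorem mono_mem_smoothVectors (n : ℕ) : mono ξ n ∈ smoothVectors ξ := by
  set g : ℂ → ℂ := fun t => Complex.exp (-(ξ + 2) * Complex.log (1 - t)) * (1 - t)⁻¹ ^ n with hg
  have hslit {t : ℂ} (ht : t ∈ disc) : 1 - t ∈ Complex.slitPlane := by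
    rw [sub_eq_add_neg]
    exact Complex.mem_slitPlane_of_norm_lt_one (by simpa using ht)
  have hgd : DifferentiableOn ℂ g disc := fun t ht => by
    have h1 : DifferentiableAt ℂ (fun t : ℂ => 1 - t) t := by fun_prop
    exact ((((h1.clog (hslit ht)).const_mul _).cexp).mul
      ((h1.fun_inv (Complex.slitPlane_ne_zero (hslit ht))).pow n)).differentiableWithinAt
  obtain ⟨Ψ, hΨ, hΨg⟩ := exists_differentiableOn_dilate ξ hgd
  set w : UniversalCover → ℂ := fun x => conj x.beta / x.alpha with hw
  have hwd (x : UniversalCover) : w x ∈ disc := by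
    rw [mem_ball_zero_iff, hw, norm_div, RCLike.norm_conj,
      div_lt_one (norm_pos_iff.2 x.alpha_ne_zero)]
    exact x.norm_beta_lt
  have hwc : ContDiff ℝ ∞ w := by
    simp only [hw, div_eq_mul_inv]
    exact (contDiff_conj_comp contDiff_beta).mul
      (contDiff_alpha.inv UniversalCover.alpha_ne_zero)
  have hu : ContDiff ℝ ∞ fun x => Ψ (w x) :=
    ((hΨ.contDiffOn isOpen_ball).restrict_scalars ℝ).comp_contDiff hwc hwd
  -- the powers of `ᾱ z - β`
  set T : ℕ → UniversalCover → A2 ξ := fun k x =>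
    ((fun v => conj x.alpha • shift ξ v - x.beta • v)^[k]) (Ψ (w x)) with hT
  have hTc (k : ℕ) : ContDiff ℝ ∞ (T k) := by
    induction k with
    | zero => exact hu
    | succ k ih =>
      simp only [hT, Function.iterate_succ_apply'] at ih ⊢
      exact ((contDiff_conj_comp contDiff_alpha).smul
        (((shift ξ).contDiff.restrict_scalars ℝ).comp ih)).sub (contDiff_beta.smul ih)
  have hTz (k : ℕ) (x : UniversalCover) {z : ℂ} (hz : z ∈ disc) :
      T k x z = (conj x.alpha * z - x.beta) ^ k * g (w x * z) := by
    induction k with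
    | zero =>
      rw [pow_zero, one_mul]
      exact hΨg _ (hwd x) z hz
    | succ k ih =>
      have : T (k + 1) x = conj x.alpha • shift ξ (T k x) - x.beta • T k x :=
        Function.iterate_succ_apply' _ _ _
      rw [this, sub_eq_add_neg, ← neg_smul, A2.coe_add, A2.coe_smul, A2.coe_smul, shift_apply, ih]
      ring
  set s : UniversalCover → ℂ := fun x =>
    Complex.exp (-(ξ + 2) * (Real.log √(1 + ‖x.2‖ ^ 2) + x.1 * Complex.I)) * (x.alpha ^ n)⁻¹
    with hs
  have hsc : ContDiff ℝ ∞ s := by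
    refine ContDiff.mul (ContDiff.cexp (contDiff_const.mul (ContDiff.add ?_ ?_)))
      ((contDiff_alpha.pow n).inv fun x => pow_ne_zero n x.alpha_ne_zero)
    · exact Complex.ofRealCLM.contDiff.comp
        (contDiff_norm_factor.log fun x => (by positivity : (0 : ℝ) < √(1 + ‖x.2‖ ^ 2)).ne')
    · exact (Complex.ofRealCLM.contDiff.comp contDiff_fst).mul contDiff_const
  have hsT : ContDiff ℝ ∞ fun x => s x • T n x := hsc.smul (hTc n)
  change ContDiff ℝ ∞ fun x => rep ξ x (mono ξ n)
  convert! hsT using 2 with x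
  refine A2.ext fun z hz => ?_
  have h1 : 1 - w x * z ≠ 0 := Complex.slitPlane_ne_zero (x.one_sub_mem_slitPlane hz)
  have h2 : x.factor z = x.alpha * (1 - w x * z) := by
    rw [UniversalCover.factor, hw]
    field_simp [x.alpha_ne_zero]
    ring
  rw [rep_apply x _ hz, mono_apply n (x.moebius_mem hz), A2.coe_smul, hTz n x hz,
    UniversalCover.moebius, h2, UniversalCover.logFactor,
    show conj x.beta / x.alpha = w x from rfl, mul_add, Complex.exp_add, hs, hg]
  simp only [div_pow, mul_pow, inv_pow]
  field_simp

theorem polySubmodule_le_smoothVectors : polySubmodule ξ ≤ smoothVectors ξ := by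
  rw [polySubmodule_eq_span, Submodule.span_le]
  rintro _ ⟨n, rfl⟩
  exact mono_mem_smoothVectors n

theorem dense_smoothVectors : Dense (smoothVectors ξ : Set (A2 ξ)) :=
  dense_polySubmodule.mono polySubmodule_le_smoothVectors

end Smooth

section Derived

variable {ξ : ℝ} [hξ : Fact (-1 < ξ)]

/-! ### The derived representation -/

theorem hasDerivAt_alpha_expLift (X : su11) :
    HasDerivAt (fun t : ℝ => (expLift X t).alpha) (X.1 0 0) 0 := by
  have h := hasDerivAt_exp_smul X.1 0 0 0
  simp only [zero_smul, NormedSpace.exp_zero, mul_one] at h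
  refine h.congr_of_eventuallyEq (Eventually.of_forall fun t => ?_)
  simpa [UniversalCover.toSU] using congrFun₂ (toSU_expLift X t) 0 0

theorem hasDerivAt_beta_expLift (X : su11) :
    HasDerivAt (fun t : ℝ => (expLift X t).beta) (X.1 0 1) 0 := by
  have h := hasDerivAt_exp_smul X.1 0 1 0
  simp only [zero_smul, NormedSpace.exp_zero, mul_one] at h
  refine h.congr_of_eventuallyEq (Eventually.of_forall fun t => ?_)
  simpa [UniversalCover.toSU] using congrFun₂ (toSU_expLift X t) 0 1

theorem alpha_zero : UniversalCover.alpha 0 = 1 := by simp [UniversalCover.alpha]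

theorem beta_zero : UniversalCover.beta 0 = 0 := rfl

theorem logFactor_zero (z : ℂ) : UniversalCover.logFactor 0 z = 0 := by
  simp [UniversalCover.logFactor, UniversalCover.beta]

theorem factor_zero (z : ℂ) : UniversalCover.factor 0 z = 1 := by
  simp [UniversalCover.factor, alpha_zero, beta_zero]

theorem moebius_zero (z : ℂ) : UniversalCover.moebius 0 z = z := by
  simp [UniversalCover.moebius, factor_zero, alpha_zero, beta_zero]

theorem hasDerivAt_factor_expLift (X : su11) (z : ℂ) :
    HasDerivAt (fun t : ℝ => (expLift X t).factor z) (-conj (X.1 0 1) * z + X.1 0 0) 0 :=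
  ((hasDerivAt_beta_expLift X).star.fun_neg.mul_const z).add (hasDerivAt_alpha_expLift X)

theorem differentiableAt_logFactor_expLift (X : su11) {z : ℂ} (hz : z ∈ disc) :
    DifferentiableAt ℝ (fun t : ℝ => (expLift X t).logFactor z) 0 := by
  have h1 : DifferentiableAt ℝ (fun t : ℝ => Real.log √(1 + ‖(expLift X t).2‖ ^ 2)) 0 :=
    DifferentiableAt.comp (g := fun x : UniversalCover => Real.log √(1 + ‖x.2‖ ^ 2)) 0
      ((contDiff_norm_factor.log fun x =>
        (by positivity : (0 : ℝ) < √(1 + ‖x.2‖ ^ 2)).ne').differentiable (by simp) _)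
      (differentiableAt_expLift X)
  have h2 : DifferentiableAt ℝ (fun t : ℝ => (expLift X t).1) 0 := (differentiableAt_expLift X).fst
  have h3 := (((hasDerivAt_beta_expLift X).star.fun_div (hasDerivAt_alpha_expLift X)
    (expLift X 0).alpha_ne_zero).mul_const z).const_sub 1
  exact ((Complex.ofRealCLM.differentiableAt.comp 0 h1).add
    ((Complex.ofRealCLM.differentiableAt.comp 0 h2).mul_const _)).add
    (h3.clog_real ((expLift X 0).one_sub_mem_slitPlane hz)).differentiableAt

/-- Only differentiability has to be read off the chosen branch. The value follows by
differentiating `exp (logFactor) = factor` at `t = 0`, where the exponential is `1`. -/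
theorem hasDerivAt_logFactor_expLift (X : su11) {z : ℂ} (hz : z ∈ disc) :
    HasDerivAt (fun t : ℝ => (expLift X t).logFactor z) (-conj (X.1 0 1) * z + X.1 0 0) 0 := by
  have h1 := (differentiableAt_logFactor_expLift X hz).hasDerivAt
  have h2 := h1.cexp
  rw [expLift_zero, logFactor_zero, Complex.exp_zero, one_mul] at h2
  have h3 := (hasDerivAt_factor_expLift X z).congr_of_eventuallyEq
    (Eventually.of_forall fun t => (expLift X t).exp_logFactor hz)
  rwa [h2.unique h3] at h1

theorem hasDerivAt_moebius_expLift (X : su11) (z : ℂ) :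
    HasDerivAt (fun t : ℝ => (expLift X t).moebius z)
      (conj (X.1 0 0) * z - X.1 0 1 - z * (-conj (X.1 0 1) * z + X.1 0 0)) 0 := by
  have h := (((hasDerivAt_alpha_expLift X).star.mul_const z).sub
    (hasDerivAt_beta_expLift X)).fun_div (hasDerivAt_factor_expLift X z)
    (by rw [expLift_zero, factor_zero]; exact one_ne_zero)
  refine h.congr_deriv ?_
  simp [expLift_zero, factor_zero, alpha_zero, beta_zero]

/-- Point evaluations are continuous on `A²_ξ`, so the derivative in norm may be computed at each
`z` by the product and chain rules. This covers every smooth vector, not only polynomials. -/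
theorem derivedRep_apply (X : su11) (v : (derivedRep ξ X).domain) {z : ℂ} (hz : z ∈ disc) :
    derivedRep ξ X v z =
      (conj (X.1 0 0) * z - X.1 0 1 - z * (-conj (X.1 0 1) * z + X.1 0 0)) * deriv (v : A2 ξ) z -
        (ξ + 2) * (-conj (X.1 0 1) * z + X.1 0 0) * (v : A2 ξ) z := by
  have h1 : HasDerivAt (fun t : ℝ => rep ξ (expLift X t) (v : A2 ξ)) (derivedRep ξ X v) 0 :=
    (differentiableAt_rep_expLift X v.2).hasDerivAt
  have h2 : HasDerivAt (fun t : ℝ => rep ξ (expLift X t) (v : A2 ξ) z) (derivedRep ξ X v z) 0 :=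
    ((evalCLM ξ z).restrictScalars ℝ).hasFDerivAt.comp_hasDerivAt 0 h1
  have h3 : HasDerivAt (fun t : ℝ => (v : A2 ξ) ((expLift X t).moebius z)) _ 0 :=
    HasDerivAt.comp_of_eq 0 ((v : A2 ξ).differentiableAt hz).hasDerivAt
      (hasDerivAt_moebius_expLift X z) (by rw [expLift_zero, moebius_zero])
  have h4 := ((hasDerivAt_logFactor_expLift X hz).const_mul (-((ξ : ℂ) + 2))).cexp.mul h3
  have h5 := h4.congr_of_eventuallyEq
    (Eventually.of_forall fun t => rep_apply (expLift X t) (v : A2 ξ) hz)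
  rw [h2.unique h5]
  simp only [expLift_zero, logFactor_zero, moebius_zero, mul_zero, Complex.exp_zero]
  ring

/-- The inner product of `π_ξ(exp(tX)) v` and `π_ξ(exp(tX)) w` does not depend on `t`; differentiate
at `0`. The group law is not needed. -/
theorem inner_derivedRep (X : su11) (v w : (derivedRep ξ X).domain) :
    inner ℂ (derivedRep ξ X v) (w : A2 ξ) = -inner ℂ (v : A2 ξ) (derivedRep ξ X w) := by
  have h1 (v : (derivedRep ξ X).domain) :
      HasDerivAt (fun t : ℝ => rep ξ (expLift X t) (v : A2 ξ)) (derivedRep ξ X v) 0 :=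
    (differentiableAt_rep_expLift X v.2).hasDerivAt
  have hr (u : A2 ξ) : rep ξ 0 u = u := A2.ext fun z hz => by
    rw [rep_apply _ _ hz, logFactor_zero, moebius_zero]
    simp
  have h2 := (h1 v).inner ℂ (h1 w)
  simp only [(rep ξ _).inner_map_map, expLift_zero, hr] at h2
  linear_combination -(hasDerivAt_const (0 : ℝ) (inner ℂ (v : A2 ξ) (w : A2 ξ))).unique h2

end Derived

/-! ### Jacobi operators -/

section Jacobi

variable {E : Type*} [NormedAddCommGroup E] [InnerProductSpace ℂ E]

/-- The squared norm is the sum over `n < N` of `(|mₙ|/N)² |aₙ|²`. Each term tends to `0`, and `|mₙ|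
≤ C(n+1) ≤ CN` bounds it by `C²|aₙ|²`, so dominated convergence applies. This is where linear growth
is used. -/
theorem tendsto_inv_smul_sum_of_linear_growth {v : ℕ → E} (hv : Orthonormal ℂ v) {a : ℕ → ℂ}
    (ha : Summable fun n => ‖a n‖ ^ 2) {m : ℕ → ℂ} {C : ℝ} (hm : ∀ n, ‖m n‖ ≤ C * (n + 1)) :
    Tendsto (fun N : ℕ => (N : ℂ)⁻¹ • ∑ n ∈ Finset.range N, (m n * a n) • v n) atTop (𝓝 0) := by
  have hnorm (N : ℕ) : ‖(N : ℂ)⁻¹ • ∑ n ∈ Finset.range N, (m n * a n) • v n‖ ^ 2 =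
      ∑' n, if n < N then (‖m n‖ / N) ^ 2 * ‖a n‖ ^ 2 else 0 := by
    have h1 : ‖∑ n ∈ Finset.range N, (m n * a n) • v n‖ ^ 2 =
        ∑ n ∈ Finset.range N, ‖m n * a n‖ ^ 2 := by
      rw [← Complex.ofReal_inj, Complex.ofReal_pow]
      refine (inner_self_eq_norm_sq_to_K (𝕜 := ℂ) (E := E) _).symm.trans ?_
      rw [hv.inner_sum]
      push_cast
      exact Finset.sum_congr rfl fun n _ => Complex.conj_mul' _
    rw [norm_smul, mul_pow, h1, tsum_eq_sum (s := Finset.range N) fun n hn =>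
      if_neg (by simpa using hn), Finset.mul_sum]
    refine Finset.sum_congr rfl fun n hn => ?_
    rw [if_pos (Finset.mem_range.1 hn), norm_inv, Complex.norm_natCast, norm_mul]
    ring
  have hlim : Tendsto (fun N : ℕ => ∑' n, if n < N then (‖m n‖ / N) ^ 2 * ‖a n‖ ^ 2 else 0) atTop
      (𝓝 (∑' _ : ℕ, (0 : ℝ))) := by
    refine tendsto_tsum_of_dominated_convergence (bound := fun n => C ^ 2 * ‖a n‖ ^ 2)
      (ha.mul_left _) (fun n => ?_) (Eventually.of_forall fun N n => ?_)
    · have h1 : Tendsto (fun N : ℕ => (‖m n‖ / N) ^ 2 * ‖a n‖ ^ 2) atTop (𝓝 0) := by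
        simpa using ((tendsto_const_div_atTop_nhds_zero_nat ‖m n‖).pow 2).mul_const (‖a n‖ ^ 2)
      refine h1.congr' ?_
      filter_upwards [eventually_gt_atTop n] with N hN
      rw [if_pos hN]
    · split_ifs with h
      · rw [Real.norm_of_nonneg (by positivity)]
        have hN : (0 : ℝ) < N := by exact_mod_cast (Nat.zero_le n).trans_lt h
        have hC : 0 ≤ C := nonneg_of_mul_nonneg_left ((norm_nonneg _).trans (hm n)) (by positivity)
        have h2 : ‖m n‖ / N ≤ C := by
          rw [div_le_iff₀ hN]
          have : (n : ℝ) + 1 ≤ N := by exact_mod_cast h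
          exact (hm n).trans (by gcongr)
        gcongr
      · rw [norm_zero]
        positivity
  simp only [tsum_zero] at hlim
  rw [tendsto_zero_iff_norm_tendsto_zero]
  have h := hlim.sqrt
  simp only [← hnorm, Real.sqrt_zero, Real.sqrt_sq (norm_nonneg _)] at h
  exact h

/-- A symmetric operator which is tridiagonal in a Hilbert basis, with off-diagonal entries of at
most linear growth, is essentially self-adjoint: its maximal extension lies in the closure of
its restriction to finite linear combinations of the basis. -/
theorem mem_topologicalClosure_of_jacobi (e : HilbertBasis ℕ ℂ E) {l : ℕ → E} {A : ℕ → ℂ}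
    {D : ℕ → ℝ} {C : ℝ} (hA : ∀ n, ‖A n‖ ≤ C * (n + 1))
    (hl0 : l 0 = A 0 • e 1 + (D 0 : ℂ) • e 0)
    (hl : ∀ n, l (n + 1) = A (n + 1) • e (n + 2) + (D (n + 1) : ℂ) • e (n + 1) + conj (A n) • e n)
    {G : Submodule ℂ (E × E)} (hG : ∀ n, (e n, l n) ∈ G) {u w : E}
    (huw : ∀ n, inner ℂ (l n) u = inner ℂ (e n) w) : (u, w) ∈ G.topologicalClosure := by
  set a : ℕ → ℂ := fun n => inner ℂ (e n) u with ha
  set b : ℕ → ℂ := fun n => inner ℂ (e n) w with hb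
  -- The hypothesis `huw` puts `(u, w)` in the graph of the adjoint; in coordinates it is a
  -- three-term recurrence.
  have hb0 : b 0 = conj (A 0) * a 1 + D 0 * a 0 := by
    simp only [hb, ha, ← huw, hl0, inner_add_left, inner_smul_left, Complex.conj_ofReal]
  have hb1 (n : ℕ) : b (n + 1) =
      conj (A (n + 1)) * a (n + 2) + D (n + 1) * a (n + 1) + A n * a n := by
    simp only [hb, ha, ← huw, hl, inner_add_left, inner_smul_left, Complex.conj_ofReal,
      Complex.conj_conj]
  have hsa : Summable fun n => ‖a n‖ ^ 2 := e.orthonormal.inner_products_summable u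
  have hsb : Summable fun n => ‖b n‖ ^ 2 := e.orthonormal.inner_products_summable w
  have hos : Orthonormal ℂ fun n => e (n + 1) :=
    e.orthonormal.comp _ (add_left_injective 1)
  -- the Fejér means of `u` and of `w`
  set φ : ℕ → ℕ → ℂ := fun N n => 1 - (N : ℂ)⁻¹ * n with hφ
  have hmean (x : E) : Tendsto (fun N : ℕ => ∑ n ∈ Finset.range N,
      (φ N n * inner ℂ (e n) x) • e n) atTop (𝓝 x) := by
    have h1 : Tendsto (fun N : ℕ => ∑ n ∈ Finset.range N, inner ℂ (e n) x • e n) atTop (𝓝 x) := by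
      simpa only [e.repr_apply_apply] using (e.hasSum_repr x).tendsto_sum_nat
    -- The Fejér mean is the partial sum minus `N⁻¹ ∑ n aₙ eₙ`, and the correction tends to `0`.
    have h2 := tendsto_inv_smul_sum_of_linear_growth e.orthonormal
      (e.orthonormal.inner_products_summable x) (m := fun n => n) (C := 1)
      (fun n => by simp)
    have h3 := h1.sub h2
    rw [sub_zero] at h3
    refine h3.congr fun N => ?_
    rw [Finset.smul_sum, ← Finset.sum_sub_distrib]
    refine Finset.sum_congr rfl fun n _ => ?_
    rw [smul_smul, ← sub_smul]
    congr 1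
    simp only [hφ]
    ring
  -- The raising and the lowering half of the commutator of the matrix with the Fejér cutoff both
  -- tend to `0`.
  have hK1 := tendsto_inv_smul_sum_of_linear_growth hos hsa hA
  have hK2 := tendsto_inv_smul_sum_of_linear_growth e.orthonormal
    ((summable_nat_add_iff 1).2 hsa) (m := fun n => conj (A n)) (C := C)
    (fun n => by rw [RCLike.norm_conj]; exact hA n)
  -- The diagonal commutes with the cutoff; off the diagonal, consecutive weights differ by exactly
  -- `1/(N+1)`, which becomes the factor in front of the two sums.
  have hcomm (N : ℕ) : ∑ n ∈ Finset.range (N + 1), (φ (N + 1) n * a n) • l n =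
      ∑ n ∈ Finset.range (N + 1), (φ (N + 1) n * b n) • e n +
      (((N + 1 : ℕ) : ℂ)⁻¹ • ∑ n ∈ Finset.range (N + 1), (A n * a n) • e (n + 1) -
        ((N + 1 : ℕ) : ℂ)⁻¹ • ∑ n ∈ Finset.range (N + 1), (conj (A n) * a (n + 1)) • e n) := by
    -- The weight vanishes at the cutoff index, so the boundary terms of both index shifts
    -- disappear. Using `N + 1` avoids the junk value of `N⁻¹` at `0`.
    have hN : φ (N + 1) (N + 1) = 0 := by
      have : ((N + 1 : ℕ) : ℂ) ≠ 0 := Nat.cast_ne_zero.2 N.succ_ne_zero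
      simp only [hφ, inv_mul_cancel₀ this, sub_self]
    have hd (n : ℕ) : ((N + 1 : ℕ) : ℂ)⁻¹ = φ (N + 1) n - φ (N + 1) (n + 1) := by
      simp only [hφ]
      push_cast
      ring
    have e1 : ∑ n ∈ Finset.range (N + 1), (φ (N + 1) n * a n) • l n =
        ∑ n ∈ Finset.range (N + 1), (φ (N + 1) n * a n) • (A n • e (n + 1) + (D n : ℂ) • e n) +
        ∑ n ∈ Finset.range (N + 1), (φ (N + 1) (n + 1) * a (n + 1)) • conj (A n) • e n := by
      rw [Finset.sum_range_succ (fun n => (φ (N + 1) (n + 1) * a (n + 1)) • conj (A n) • e n), hN,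
        zero_mul, zero_smul, add_zero, Finset.sum_range_succ', Finset.sum_range_succ' (fun n =>
          (φ (N + 1) n * a n) • (A n • e (n + 1) + (D n : ℂ) • e n)), add_right_comm,
        ← Finset.sum_add_distrib, hl0]
      simp only [hl, smul_add, zero_add]
    have e2 : ∑ n ∈ Finset.range (N + 1), (φ (N + 1) n * b n) • e n =
        ∑ n ∈ Finset.range (N + 1),
          (φ (N + 1) n * (conj (A n) * a (n + 1) + D n * a n)) • e n +
        ∑ n ∈ Finset.range (N + 1), (φ (N + 1) (n + 1) * (A n * a n)) • e (n + 1) := by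
      rw [Finset.sum_range_succ (fun n => (φ (N + 1) (n + 1) * (A n * a n)) • e (n + 1)), hN,
        zero_mul, zero_smul, add_zero, Finset.sum_range_succ', Finset.sum_range_succ' (fun n =>
          (φ (N + 1) n * (conj (A n) * a (n + 1) + D n * a n)) • e n), add_right_comm,
        ← Finset.sum_add_distrib, hb0]
      simp only [hb1, mul_add, add_smul, zero_add]
    rw [e1, e2, Finset.smul_sum, Finset.smul_sum, ← Finset.sum_sub_distrib,
      ← Finset.sum_add_distrib, ← Finset.sum_add_distrib, ← Finset.sum_add_distrib]
    refine Finset.sum_congr rfl fun n _ => ?_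
    rw [hd n]
    module
  have hlimL : Tendsto (fun N : ℕ => ∑ n ∈ Finset.range (N + 1), (φ (N + 1) n * a n) • l n) atTop
      (𝓝 w) := by
    have h := ((hmean w).comp (tendsto_add_atTop_nat 1)).add
      ((hK1.comp (tendsto_add_atTop_nat 1)).sub (hK2.comp (tendsto_add_atTop_nat 1)))
    simp only [sub_zero, add_zero] at h
    exact h.congr fun N => (hcomm N).symm
  have hlimU := (hmean u).comp (tendsto_add_atTop_nat 1)
  refine mem_closure_of_tendsto (hlimU.prodMk_nhds hlimL) (Eventually.of_forall fun N => ?_)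
  have : (∑ n ∈ Finset.range (N + 1), (φ (N + 1) n * a n) • e n,
      ∑ n ∈ Finset.range (N + 1), (φ (N + 1) n * a n) • l n) =
      ∑ n ∈ Finset.range (N + 1), (φ (N + 1) n * a n) • (e n, l n) := by
    simp only [Prod.smul_mk, Prod.fst_sum, Prod.snd_sum, Prod.ext_iff, and_self]
  change (_, _) ∈ G
  simp only [Function.comp_apply]
  rw [this]
  exact G.sum_mem fun n _ => G.smul_mem _ (hG n)

end Jacobi

/-! ### Closures of skew-symmetric and of symmetric operators -/

section Closure

variable {E : Type*} [NormedAddCommGroup E] [InnerProductSpace ℂ E]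

/-- Skew-symmetry against a fixed `y` in the domain is a closed condition on pairs, so it passes to
the closure of the graph. A pair `(0, x)` there has `x` orthogonal to the dense domain. -/
theorem isClosable_of_skew {T : E →ₗ.[ℂ] E} (hT : Dense (T.domain : Set E))
    (h : ∀ v w : T.domain, inner ℂ (T v) (w : E) = -inner ℂ (v : E) (T w)) : T.IsClosable := by
  refine ⟨T.graph.topologicalClosure.toLinearPMap,
    (Submodule.toLinearPMap_graph_eq _ fun x hx hx0 => ?_).symm⟩
  refine hT.eq_zero_of_inner_left (𝕜 := ℂ) fun y hy => ?_
  have hcl : IsClosed {p : E × E | inner ℂ p.2 y + inner ℂ p.1 (T ⟨y, hy⟩) = 0} :=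
    isClosed_eq (by fun_prop) continuous_const
  have hsub : (T.graph : Set (E × E)) ⊆
      {p : E × E | inner ℂ p.2 y + inner ℂ p.1 (T ⟨y, hy⟩) = 0} := by
    intro p hp
    obtain ⟨v, h1, h2⟩ := (T.mem_graph_iff).1 hp
    rw [mem_ofPred_eq, ← h1, ← h2, h v ⟨y, hy⟩, neg_add_cancel]
  have := closure_minimal hsub hcl hx
  simpa [hx0] using this

theorem adjoint_topologicalClosure (g : Submodule ℂ (E × E)) :
    g.topologicalClosure.adjoint = g.adjoint := by
  ext x
  simp only [Submodule.mem_adjoint_iff]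
  refine ⟨fun h a b hab => h a b (g.le_topologicalClosure hab), fun h a b hab => ?_⟩
  have hcl : IsClosed {p : E × E | inner ℂ p.2 x.1 - inner ℂ p.1 x.2 = 0} :=
    isClosed_eq (by fun_prop) continuous_const
  exact closure_minimal (fun p hp => h p.1 p.2 hp) hcl hab

theorem inner_left_of_le {L S : E →ₗ.[ℂ] E} (hle : L ≤ S) (hS : S.IsFormalAdjoint S)
    (x : L.domain) (v : S.domain) : inner ℂ (L x) (v : E) = inner ℂ (x : E) (S v) := by
  rw [hle.2 (x := x) (y := ⟨x, hle.1 x.2⟩) rfl]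
  exact hS ⟨x, hle.1 x.2⟩ v

theorem isFormalAdjoint_of_le {L S : E →ₗ.[ℂ] E} (hle : L ≤ S) (hS : S.IsFormalAdjoint S) :
    L.IsFormalAdjoint L := fun x y => by
  rw [hle.2 (x := y) (y := ⟨y, hle.1 y.2⟩) rfl]
  exact inner_left_of_le hle hS x ⟨y, hle.1 y.2⟩

/-- The hypothesis `h` says that the graph of `L*` lies in the closure of the graph of `L`. Symmetry
and closedness of `L*` give the reverse inclusion, and passing to the closure does not change the
adjoint. -/
theorem isSelfAdjoint_closure [CompleteSpace E] {L : E →ₗ.[ℂ] E}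
    (hd : Dense (L.domain : Set E)) (hL : L.IsFormalAdjoint L)
    (h : ∀ u w, (∀ x : L.domain, inner ℂ (L x) u = inner ℂ (x : E) w) →
      (u, w) ∈ L.graph.topologicalClosure) : L.IsClosable ∧ IsSelfAdjoint L.closure := by
  have hle : L ≤ L.adjoint := hL.le_adjoint hd
  have hc : L.IsClosable := (LinearPMap.adjoint_isClosed hd).isClosable.leIsClosable hle
  refine ⟨hc, LinearPMap.isSelfAdjoint_def.2 (LinearPMap.eq_of_eq_graph ?_)⟩
  rw [LinearPMap.adjoint_graph_eq_graph_adjoint (hd.mono L.le_closure.1),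
    ← hc.graph_closure_eq_closure_graph, adjoint_topologicalClosure]
  refine le_antisymm (fun p hp => ?_) ?_
  · refine h p.1 p.2 fun x => ?_
    exact sub_eq_zero.1 ((Submodule.mem_adjoint_iff _ _).1 hp x (L x) (L.mem_graph x))
  · rw [← LinearPMap.adjoint_graph_eq_graph_adjoint hd]
    exact Submodule.topologicalClosure_minimal _ (LinearPMap.le_graph_of_le hle)
      (LinearPMap.adjoint_isClosed hd)

/-! ### Graphs and closures of operators `i T + d` -/

variable {ξ : ℝ} [hξ : Fact (-1 < ξ)]

theorem iMulAdd_apply (T : A2 ξ →ₗ.[ℂ] A2 ξ) (d : ℝ) (v : (iMulAdd T d).domain) :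
    iMulAdd T d v = (d : ℂ) • (v : A2 ξ) + Complex.I • T v := rfl

theorem mem_graph_iMulAdd {T : A2 ξ →ₗ.[ℂ] A2 ξ} {d : ℝ} {p : A2 ξ × A2 ξ} :
    p ∈ (iMulAdd T d).graph ↔ (p.1, -Complex.I • (p.2 - (d : ℂ) • p.1)) ∈ T.graph := by
  simp only [LinearPMap.mem_graph_iff]
  refine exists_congr fun v => and_congr_right fun hv => ?_
  rw [iMulAdd_apply, ← hv]
  constructor
  · intro h
    rw [← h, add_sub_cancel_left, smul_smul]
    simp
  · intro h
    rw [h, smul_smul]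
    simp

/-- A homeomorphism of the product, the same for `T` and its closure, takes the graph of `i T + d`
to that of `T`; homeomorphisms commute with closures. -/
theorem topologicalClosure_graph_iMulAdd {T : A2 ξ →ₗ.[ℂ] A2 ξ} (hT : T.IsClosable) (d : ℝ) :
    (iMulAdd T d).graph.topologicalClosure = (iMulAdd T.closure d).graph := by
  set Φ : A2 ξ × A2 ξ ≃ₜ A2 ξ × A2 ξ :=
    { toFun := fun p => (p.1, -Complex.I • (p.2 - (d : ℂ) • p.1))
      invFun := fun p => (p.1, Complex.I • p.2 + (d : ℂ) • p.1)
      left_inv := fun p => by simp [smul_smul]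
      right_inv := fun p => by simp [smul_smul]
      continuous_toFun := by fun_prop
      continuous_invFun := by fun_prop } with hΦ
  have h (S : A2 ξ →ₗ.[ℂ] A2 ξ) :
      ((iMulAdd S d).graph : Set (A2 ξ × A2 ξ)) = Φ ⁻¹' (S.graph : Set (A2 ξ × A2 ξ)) :=
    Set.ext fun p => mem_graph_iMulAdd
  refine SetLike.coe_injective ?_
  rw [Submodule.topologicalClosure_coe, h, h, ← hT.graph_closure_eq_closure_graph,
    Submodule.topologicalClosure_coe, Φ.preimage_closure]

theorem closure_iMulAdd {T : A2 ξ →ₗ.[ℂ] A2 ξ} (hT : T.IsClosable) (d : ℝ) :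
    (iMulAdd T d).IsClosable ∧ (iMulAdd T d).closure = iMulAdd T.closure d := by
  have h := topologicalClosure_graph_iMulAdd hT d
  have hc : (iMulAdd T d).IsClosable := ⟨_, h⟩
  exact ⟨hc, LinearPMap.eq_of_eq_graph (hc.graph_closure_eq_closure_graph.symm.trans h)⟩

theorem isFormalAdjoint_iMulAdd {T : A2 ξ →ₗ.[ℂ] A2 ξ}
    (h : ∀ v w : T.domain, inner ℂ (T v) (w : A2 ξ) = -inner ℂ (v : A2 ξ) (T w)) (d : ℝ) :
    (iMulAdd T d).IsFormalAdjoint (iMulAdd T d) := fun v w => by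
  rw [iMulAdd_apply, iMulAdd_apply, inner_add_left, inner_add_right, inner_smul_left,
    inner_smul_left, inner_smul_right, inner_smul_right, Complex.conj_ofReal, Complex.conj_I,
    h v w]
  ring

end Closure

/-! ### First-order differential operators on the monomials -/

section DiffOp

theorem diffOp_apply {ξ : ℝ} (f g : A2 ξ) (h : (diffOp f g).domain) {z : ℂ} (hz : z ∈ disc) :
    diffOp f g h z = f z * deriv (h : A2 ξ) z + g z * (h : A2 ξ) z := by
  change A2.mk (disc.indicator _) _ z = _
  rw [A2.mk_apply, indicator_of_mem hz]

variable {ξ : ℝ} [hξ : Fact (-1 < ξ)]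

theorem deriv_mono (n : ℕ) {z : ℂ} (hz : z ∈ disc) :
    deriv (mono ξ n) z = n * z ^ (n - 1) := by
  rw [EventuallyEq.deriv_eq (eventually_of_mem (isOpen_ball.mem_nhds hz)
    fun w hw => mono_apply n hw), deriv_pow_field]

/-- For `n = 0` the truncated exponent `n - 1` is harmless, because its coefficient is zero. -/
theorem diffOp_mono (f g : A2 ξ) (n : ℕ) :
    diffOp f g ⟨mono ξ n, mono_mem n⟩ =
      (n : ℂ) • (shift ξ ^ (n - 1)) f + (shift ξ ^ n) g :=
  A2.ext fun z hz => by
    rw [diffOp_apply f g _ hz, deriv_mono n hz, mono_apply n hz, A2.coe_add, A2.coe_smul,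
      shift_pow_apply, shift_pow_apply]
    ring

theorem inner_mono_self (n : ℕ) : inner ℂ (mono ξ n) (mono ξ n) = (‖mono ξ n‖ : ℂ) ^ 2 :=
  inner_self_eq_norm_sq_to_K _

/-! ### The operators of part (1) as restrictions of `i π_ξ(X) + d` -/

/-- The leading coefficient of the operator `(c z² + a z + c̄) d/dz + ((ξ + 2) c z + b)`. -/
def quad (ξ : ℝ) [Fact (-1 < ξ)] (a : ℝ) (c : ℂ) : A2 ξ :=
  c • mono ξ 2 + (a : ℂ) • mono ξ 1 + conj c • mono ξ 0

/-- The zeroth-order coefficient of the operator `(c z² + a z + c̄) d/dz + ((ξ + 2) c z + b)`. -/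
def lin (ξ : ℝ) [Fact (-1 < ξ)] (b : ℝ) (c : ℂ) : A2 ξ :=
  (((ξ : ℂ) + 2) * c) • mono ξ 1 + (b : ℂ) • mono ξ 0

theorem quad_apply (a : ℝ) (c : ℂ) {z : ℂ} (hz : z ∈ disc) :
    quad ξ a c z = c * z ^ 2 + a * z + conj c := by
  rw [quad, A2.coe_add, A2.coe_add, A2.coe_smul, A2.coe_smul, A2.coe_smul, mono_apply _ hz,
    mono_apply _ hz, mono_apply _ hz]
  ring

theorem lin_apply (b : ℝ) (c : ℂ) {z : ℂ} (hz : z ∈ disc) :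
    lin ξ b c z = (ξ + 2) * c * z + b := by
  rw [lin, A2.coe_add, A2.coe_smul, A2.coe_smul, mono_apply _ hz, mono_apply _ hz]
  ring

theorem ofPoly_quad (a : ℝ) (c : ℂ) : ofPoly ξ (Polynomial.C c * Polynomial.X ^ 2 +
    Polynomial.C (a : ℂ) * Polynomial.X + Polynomial.C (starRingEnd ℂ c)) = quad ξ a c :=
  A2.ext fun z hz => by
    rw [ofPoly_apply _ hz, quad_apply _ _ hz]
    simp

theorem ofPoly_lin (b : ℝ) (c : ℂ) : ofPoly ξ (Polynomial.C (((ξ : ℂ) + 2) * c) * Polynomial.X +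
    Polynomial.C (b : ℂ)) = lin ξ b c :=
  A2.ext fun z hz => by
    rw [ofPoly_apply _ hz, lin_apply _ _ hz]
    simp

/-- The element `X` of `su(1,1)` with `(c z² + a z + c̄) d/dz + ((ξ + 2) c z + b) = i π_ξ(X) + d`
for a real number `d`. -/
def liftSU (a : ℝ) (c : ℂ) : su11 :=
  ⟨!![Complex.I * (a / 2 : ℝ), Complex.I * conj c; conj (Complex.I * conj c),
    -(Complex.I * (a / 2 : ℝ))], a / 2, Complex.I * conj c, rfl⟩

/-- For the matrix with entries `ia/2` and `ic̄`, the operator `iπ_ξ(X)` is `(cz² + az + c̄) d/dz +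
(ξ+2)(cz + a/2)`. The constant `b - (ξ+2)a/2` corrects the zeroth-order term. -/
theorem diffOp_le_iMulAdd (a b : ℝ) (c : ℂ) :
    diffOp (quad ξ a c) (lin ξ b c) ≤
      iMulAdd (derivedRep ξ (liftSU a c)) (b - (ξ + 2) * (a / 2)) := by
  refine ⟨polySubmodule_le_smoothVectors, fun v w hvw => A2.ext fun z hz => ?_⟩
  have h00 : (liftSU a c).1 0 0 = Complex.I * (a / 2 : ℝ) := rfl
  have h01 : (liftSU a c).1 0 1 = Complex.I * conj c := rfl
  have hX := derivedRep_apply (liftSU a c) (show (derivedRep ξ (liftSU a c)).domain from w) hz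
  rw [h00, h01] at hX
  refine (diffOp_apply _ _ v hz).trans (Eq.trans ?_
    (congrArg (fun t : ℂ => ((b - (ξ + 2) * (a / 2) : ℝ) : ℂ) * (w : A2 ξ) z + Complex.I * t)
      hX.symm))
  rw [quad_apply _ _ hz, lin_apply _ _ hz, hvw]
  simp only [map_mul, Complex.conj_I, Complex.conj_conj, Complex.conj_ofReal]
  push_cast
  linear_combination ((c * z ^ 2 + a * z + conj c) * deriv (w : A2 ξ) z +
    (ξ + 2) * (c * z + a / 2) * (w : A2 ξ) z) * Complex.I_mul_I

theorem isFormalAdjoint_diffOp (a b : ℝ) (c : ℂ) :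
    (diffOp (quad ξ a c) (lin ξ b c)).IsFormalAdjoint (diffOp (quad ξ a c) (lin ξ b c)) :=
  isFormalAdjoint_of_le (diffOp_le_iMulAdd a b c)
    (isFormalAdjoint_iMulAdd (inner_derivedRep (liftSU a c)) _)

theorem diffOp_mono_zero (a b : ℝ) (c : ℂ) :
    diffOp (quad ξ a c) (lin ξ b c) ⟨mono ξ 0, mono_mem 0⟩ =
      (c * (ξ + 2)) • mono ξ 1 + (b : ℂ) • mono ξ 0 := by
  rw [diffOp_mono]
  simp [lin, mul_comm]

theorem diffOp_mono_succ (a b : ℝ) (c : ℂ) (n : ℕ) :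
    diffOp (quad ξ a c) (lin ξ b c) ⟨mono ξ (n + 1), mono_mem (n + 1)⟩ =
      (c * ((n + 1 : ℕ) + ξ + 2)) • mono ξ (n + 2) +
        ((a * (n + 1 : ℕ) + b : ℝ) : ℂ) • mono ξ (n + 1) + (conj c * (n + 1 : ℕ)) • mono ξ n := by
  rw [diffOp_mono, quad, lin]
  simp only [map_add, map_smul, shift_pow_mono, Nat.add_sub_cancel, add_zero]
  push_cast
  module

/-- The recursion for the norms of the monomials, from the skew-symmetry of `π_ξ(X)`. -/
theorem norm_mono_recursion (n : ℕ) :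
    (n + ξ + 2) * (‖mono ξ (n + 1)‖ : ℂ) ^ 2 = (n + 1) * (‖mono ξ n‖ : ℂ) ^ 2 := by
  -- The choice `a = b = 0`, `c = 1` leaves one raising and one lowering term; pairing `L zⁿ` with
  -- `zⁿ⁺¹` picks out the two norms.
  have h := isFormalAdjoint_diffOp (ξ := ξ) 0 0 1 ⟨_, mono_mem n⟩ ⟨_, mono_mem (n + 1)⟩
  have h1 : inner ℂ (diffOp (quad ξ 0 1) (lin ξ 0 1) ⟨mono ξ n, mono_mem n⟩) (mono ξ (n + 1)) =
      (n + ξ + 2) * (‖mono ξ (n + 1)‖ : ℂ) ^ 2 := by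
    cases n with
    | zero =>
      rw [diffOp_mono_zero, inner_add_left, inner_smul_left, inner_smul_left, inner_mono_self,
        inner_mono (by omega : 0 ≠ 0 + 1)]
      simp [map_ofNat]
    | succ n =>
      rw [diffOp_mono_succ, inner_add_left, inner_add_left, inner_smul_left, inner_smul_left,
        inner_smul_left, inner_mono_self, inner_mono (by omega : n + 1 ≠ n + 1 + 1),
        inner_mono (by omega : n ≠ n + 1 + 1)]
      simp [map_ofNat]
  have h2 : inner ℂ (mono ξ n)
      (diffOp (quad ξ 0 1) (lin ξ 0 1) ⟨mono ξ (n + 1), mono_mem (n + 1)⟩) =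
      (n + 1) * (‖mono ξ n‖ : ℂ) ^ 2 := by
    rw [diffOp_mono_succ, inner_add_right, inner_add_right, inner_smul_right, inner_smul_right,
      inner_smul_right, inner_mono_self, inner_mono (by omega : n ≠ n + 1),
      inner_mono (by omega : n ≠ n + 2)]
    simp
  exact h1.symm.trans (h.trans h2)

/-! ### The Jacobi matrix in the orthonormal basis and the closure of `L` -/

/-- The off-diagonal matrix entries in the basis of normalized monomials. -/
def offDiag (ξ : ℝ) [Fact (-1 < ξ)] (c : ℂ) (n : ℕ) : ℂ :=
  c * (n + ξ + 2) * (‖mono ξ (n + 1)‖ / ‖mono ξ n‖ : ℝ)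

theorem norm_offDiag_le (c : ℂ) (n : ℕ) :
    ‖offDiag ξ c n‖ ≤ ‖c‖ * (ξ + 3) * (n + 1) := by
  have hξ' : -1 < ξ := hξ.out
  have h1 : ‖mono ξ (n + 1)‖ / ‖mono ξ n‖ ≤ 1 :=
    (div_le_one (norm_mono_pos n)).2 (norm_mono_succ_le n)
  have h2 : ‖(n : ℂ) + ξ + 2‖ ≤ (ξ + 3) * (n + 1) := by
    have : (n : ℂ) + ξ + 2 = ((n + ξ + 2 : ℝ) : ℂ) := by push_cast; ring
    have hn : (0 : ℝ) ≤ n := n.cast_nonneg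
    rw [this, Complex.norm_real, Real.norm_of_nonneg (by linarith)]
    nlinarith
  rw [offDiag, norm_mul, norm_mul, Complex.norm_real, Real.norm_of_nonneg (by positivity),
    mul_assoc ‖c‖ (ξ + 3)]
  have h3 : ‖c‖ * ‖(n : ℂ) + ξ + 2‖ ≤ ‖c‖ * ((ξ + 3) * (n + 1)) := by gcongr
  exact (mul_le_of_le_one_right (by positivity) h1).trans h3

/-- The norm recursion makes the matrix Hermitian: after normalization the lowering coefficient
`c̄(n+1)` is the conjugate of the raising one. -/
theorem conj_offDiag (c : ℂ) (n : ℕ) :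
    conj (offDiag ξ c n) * ‖mono ξ (n + 1)‖ = conj c * (n + 1) * ‖mono ξ n‖ := by
  have h0 := norm_mono_ne (ξ := ξ) n
  simp only [offDiag, map_mul, map_add, Complex.conj_ofReal, map_natCast, map_ofNat]
  push_cast
  field_simp
  linear_combination conj c * norm_mono_recursion (ξ := ξ) n

theorem offDiag_mul_norm (c : ℂ) (n : ℕ) :
    offDiag ξ c n * ‖mono ξ n‖ = c * (n + ξ + 2) * ‖mono ξ (n + 1)‖ := by
  have h0 := norm_mono_ne (ξ := ξ) n
  rw [offDiag]
  push_cast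
  field_simp

theorem diffOp_onb (f g : A2 ξ) (n : ℕ) :
    diffOp f g ⟨onb ξ n, onb_mem n⟩ =
      (‖mono ξ n‖⁻¹ : ℂ) • diffOp f g ⟨mono ξ n, mono_mem n⟩ :=
  (diffOp f g).map_smul (‖mono ξ n‖⁻¹ : ℂ) ⟨mono ξ n, mono_mem n⟩

theorem diffOp_onb_zero (a b : ℝ) (c : ℂ) :
    diffOp (quad ξ a c) (lin ξ b c) ⟨onb ξ 0, onb_mem 0⟩ =
      offDiag ξ c 0 • onb ξ 1 + ((a * (0 : ℕ) + b : ℝ) : ℂ) • onb ξ 0 := by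
  have h0 := norm_mono_ne (ξ := ξ) 0
  have h1 := norm_mono_ne (ξ := ξ) 1
  have h2 := offDiag_mul_norm (ξ := ξ) c 0
  have h3 : (‖mono ξ 0‖⁻¹ : ℂ) * (c * (ξ + 2)) = offDiag ξ c 0 * (‖mono ξ 1‖ : ℂ)⁻¹ := by
    field_simp
    linear_combination -h2
  rw [diffOp_onb, diffOp_mono_zero, smul_add, smul_smul, h3, onb, onb]
  push_cast
  module

theorem diffOp_onb_succ (a b : ℝ) (c : ℂ) (n : ℕ) :
    diffOp (quad ξ a c) (lin ξ b c) ⟨onb ξ (n + 1), onb_mem (n + 1)⟩ =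
      offDiag ξ c (n + 1) • onb ξ (n + 2) + ((a * (n + 1 : ℕ) + b : ℝ) : ℂ) • onb ξ (n + 1) +
        conj (offDiag ξ c n) • onb ξ n := by
  have h0 := norm_mono_ne (ξ := ξ) n
  have h1 := norm_mono_ne (ξ := ξ) (n + 1)
  have h2 := norm_mono_ne (ξ := ξ) (n + 2)
  have h3 : (‖mono ξ (n + 1)‖⁻¹ : ℂ) * (c * ((n + 1 : ℕ) + ξ + 2)) =
      offDiag ξ c (n + 1) * (‖mono ξ (n + 2)‖ : ℂ)⁻¹ := by
    field_simp
    linear_combination -offDiag_mul_norm (ξ := ξ) c (n + 1)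
  have h4 : (‖mono ξ (n + 1)‖⁻¹ : ℂ) * (conj c * (n + 1 : ℕ)) =
      conj (offDiag ξ c n) * (‖mono ξ n‖ : ℂ)⁻¹ := by
    push_cast
    field_simp
    linear_combination -conj_offDiag (ξ := ξ) c n
  rw [diffOp_onb, diffOp_mono_succ, smul_add, smul_add, smul_smul, smul_smul _ (conj c * _), h3, h4,
    onb, onb, onb]
  module

theorem mem_topologicalClosure_graph_diffOp (a b : ℝ) (c : ℂ) {u w : A2 ξ}
    (huw : ∀ x : (diffOp (quad ξ a c) (lin ξ b c)).domain,
      inner ℂ (diffOp (quad ξ a c) (lin ξ b c) x) u = inner ℂ (x : A2 ξ) w) :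
    (u, w) ∈ (diffOp (quad ξ a c) (lin ξ b c)).graph.topologicalClosure := by
  refine mem_topologicalClosure_of_jacobi (onbBasis ξ)
    (l := fun n => diffOp (quad ξ a c) (lin ξ b c) ⟨onb ξ n, onb_mem n⟩)
    (D := fun n => a * n + b) (norm_offDiag_le (ξ := ξ) c) ?_ (fun n => ?_) (fun n => ?_) (fun n => ?_)
  · rw [coe_onbBasis]
    exact diffOp_onb_zero a b c
  · rw [coe_onbBasis]
    exact diffOp_onb_succ a b c n
  · rw [coe_onbBasis]
    exact LinearPMap.mem_graph _ ⟨onb ξ n, onb_mem n⟩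
  · rw [coe_onbBasis]
    exact huw ⟨onb ξ n, onb_mem n⟩

/-- One inclusion of closures is monotonicity. For the other, `i π_ξ(X) + d` is a symmetric
extension of `L`, so its graph satisfies the adjoint relation with `L` and lies in the closure of
the graph of `L`. -/
theorem exists_closure_diffOp_eq (a b : ℝ) (c : ℂ) :
    ∃ (X : su11) (d : ℝ),
      diffOp (quad ξ a c) (lin ξ b c) ≤ iMulAdd (derivedRep ξ X) d ∧
      (diffOp (quad ξ a c) (lin ξ b c)).IsClosable ∧ (derivedRep ξ X).IsClosable ∧
      (diffOp (quad ξ a c) (lin ξ b c)).closure = iMulAdd (derivedRepClosure ξ X) d ∧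
      IsSelfAdjoint (diffOp (quad ξ a c) (lin ξ b c)).closure := by
  have hle := diffOp_le_iMulAdd (ξ := ξ) a b c
  have hT : (derivedRep ξ (liftSU a c)).IsClosable :=
    isClosable_of_skew dense_smoothVectors (inner_derivedRep _)
  obtain ⟨hS, hSc⟩ := closure_iMulAdd hT (b - (ξ + 2) * (a / 2))
  obtain ⟨hL, hsa⟩ := isSelfAdjoint_closure dense_polySubmodule (isFormalAdjoint_diffOp a b c)
    fun u w => mem_topologicalClosure_graph_diffOp (ξ := ξ) a b c
  refine ⟨liftSU a c, b - (ξ + 2) * (a / 2), hle, hL, hT, ?_, hsa⟩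
  rw [derivedRepClosure, ← hSc]
  refine le_antisymm (hS.closure_mono hle) (LinearPMap.le_of_le_graph ?_)
  rw [← hS.graph_closure_eq_closure_graph, ← hL.graph_closure_eq_closure_graph]
  refine Submodule.topologicalClosure_minimal _ (fun p hp => ?_)
    (Submodule.isClosed_topologicalClosure _)
  obtain ⟨v, hv1, hv2⟩ := (LinearPMap.mem_graph_iff _).1 hp
  refine mem_topologicalClosure_graph_diffOp a b c fun x => ?_
  rw [← hv1, ← hv2]
  exact inner_left_of_le hle (isFormalAdjoint_iMulAdd (inner_derivedRep (liftSU a c)) _) x v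

/-! ### Symmetric first-order differential operators -/

/-- The `n`-th Taylor coefficient. -/
def coef (n : ℕ) (f : A2 ξ) : ℂ := inner ℂ (mono ξ n) f / (‖mono ξ n‖ : ℂ) ^ 2

theorem inner_mono_eq (n : ℕ) (f : A2 ξ) :
    inner ℂ (mono ξ n) f = (‖mono ξ n‖ : ℂ) ^ 2 * coef n f := by
  rw [coef, mul_div_cancel₀ _ (pow_ne_zero 2 (norm_mono_ne n))]

theorem coef_add (n : ℕ) (f g : A2 ξ) : coef n (f + g) = coef n f + coef n g := by
  rw [coef, inner_add_right, add_div, coef, coef]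

theorem coef_smul (n : ℕ) (c : ℂ) (f : A2 ξ) : coef n (c • f) = c * coef n f := by
  rw [coef, inner_smul_right, mul_div_assoc, coef]

theorem coef_mono_self (n : ℕ) : coef n (mono ξ n) = 1 := by
  rw [coef, inner_mono_self, div_self (pow_ne_zero 2 (norm_mono_ne n))]

theorem coef_mono {n m : ℕ} (h : n ≠ m) : coef n (mono ξ m) = 0 := by
  rw [coef, inner_mono h, zero_div]

theorem ext_coef {f g : A2 ξ} (h : ∀ n, coef n f = coef n g) : f = g :=
  sub_eq_zero.1 <| eq_zero_of_inner_mono fun n => by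
    rw [inner_sub_right, inner_mono_eq, inner_mono_eq, h, sub_self]

theorem clm_ext_mono {S T : A2 ξ →L[ℂ] ℂ} (h : ∀ n, S (mono ξ n) = T (mono ξ n)) : S = T :=
  ContinuousLinearMap.ext_on (s := range (mono ξ))
    (by rw [← polySubmodule_eq_span]; exact dense_polySubmodule) <| by
    rintro _ ⟨n, rfl⟩
    exact h n

/-- Both sides are continuous in `f`, so it suffices to check monomials; no infinite sum is
interchanged with the inner product. -/
theorem inner_mono_shift_add (j i : ℕ) (f : A2 ξ) :
    inner ℂ (mono ξ (j + i)) ((shift ξ ^ j) f) = (‖mono ξ (j + i)‖ : ℂ) ^ 2 * coef i f := by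
  have h : innerSL ℂ (mono ξ (j + i)) ∘L shift ξ ^ j =
      ((‖mono ξ (j + i)‖ : ℂ) ^ 2 / (‖mono ξ i‖ : ℂ) ^ 2) • innerSL ℂ (mono ξ i) := by
    refine clm_ext_mono fun n => ?_
    change inner ℂ (mono ξ (j + i)) ((shift ξ ^ j) (mono ξ n)) = _ * inner ℂ (mono ξ i) (mono ξ n)
    rw [shift_pow_mono]
    rcases eq_or_ne i n with rfl | hn
    · rw [inner_mono_self, inner_mono_self, div_mul_cancel₀ _ (pow_ne_zero 2 (norm_mono_ne i))]
    · rw [inner_mono hn, inner_mono (by omega), mul_zero]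
  have h1 := DFunLike.congr_fun h f
  change inner ℂ (mono ξ (j + i)) ((shift ξ ^ j) f) = _ * inner ℂ (mono ξ i) f at h1
  rw [h1, coef]
  ring

theorem inner_mono_shift_lt {m j : ℕ} (hmj : m < j) (f : A2 ξ) :
    inner ℂ (mono ξ m) ((shift ξ ^ j) f) = 0 := by
  have h : innerSL ℂ (mono ξ m) ∘L shift ξ ^ j = 0 := by
    refine clm_ext_mono fun n => ?_
    change inner ℂ (mono ξ m) ((shift ξ ^ j) (mono ξ n)) = 0
    rw [shift_pow_mono, inner_mono (by omega)]
  exact DFunLike.congr_fun h f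

theorem inner_mono_diffOp (f g : A2 ξ) (n k : ℕ) :
    inner ℂ (mono ξ (n + k)) (diffOp f g ⟨mono ξ n, mono_mem n⟩) =
      (‖mono ξ (n + k)‖ : ℂ) ^ 2 * (n * coef (k + 1) f + coef k g) := by
  rw [diffOp_mono, inner_add_right, inner_smul_right, inner_mono_shift_add]
  cases n with
  | zero => simp
  | succ n =>
    have h := inner_mono_shift_add n (k + 1) f
    rw [show n + (k + 1) = n + 1 + k by ring] at h
    rw [Nat.add_sub_cancel, h]
    ring

/-- `L zⁿ` has no powers below `n - 1`, so symmetry forbids powers above `n + 1`. What remains is a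
real diagonal and one relation between the two off-diagonals, required for all `n` at once. -/
theorem exists_eq_of_isFormalAdjoint {f g : A2 ξ} (h : (diffOp f g).IsFormalAdjoint (diffOp f g)) :
    ∃ (a b : ℝ) (c : ℂ), f = quad ξ a c ∧ g = lin ξ b c := by
  have hne (n : ℕ) : (‖mono ξ n‖ : ℂ) ^ 2 ≠ 0 := pow_ne_zero 2 (norm_mono_ne n)
  have hsym (n k : ℕ) : (‖mono ξ (n + k)‖ : ℂ) ^ 2 * (n * coef (k + 1) f + coef k g) =
      conj (inner ℂ (mono ξ n) (diffOp f g ⟨mono ξ (n + k), mono_mem (n + k)⟩)) := by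
    rw [← inner_mono_diffOp, inner_conj_symm]
    exact (h ⟨_, mono_mem (n + k)⟩ ⟨_, mono_mem n⟩).symm
  have hdiag (n : ℕ) : conj (n * coef 1 f + coef 0 g) = n * coef 1 f + coef 0 g := by
    have h1 := hsym n 0
    simp only [add_zero, zero_add] at h1
    have h2 := inner_mono_diffOp f g n 0
    simp only [add_zero, zero_add] at h2
    rw [h2, map_mul, map_pow, Complex.conj_ofReal] at h1
    exact (mul_left_cancel₀ (hne n) h1).symm
  -- The entry between `zⁿ` and `zⁿ⁺¹`; the norm recursion turns `(n+1)‖zⁿ‖²` into `(n+ξ+2)‖zⁿ⁺¹‖²`,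
  -- which cancels. The cases `n = 0, 1` will express `coef 1 g` and `coef 2 f` through `coef 0 f`.
  have hoff (n : ℕ) : n * coef 2 f + coef 1 g = (n + ξ + 2) * conj (coef 0 f) := by
    have h1 := hsym n 1
    have h2 := inner_mono_shift_add n 0 f
    rw [add_zero] at h2
    rw [diffOp_mono, inner_add_right, inner_smul_right, inner_mono_shift_lt (Nat.lt_succ_self n),
      Nat.add_sub_cancel, h2, add_zero, map_mul, map_mul, map_pow, Complex.conj_ofReal,
      map_natCast] at h1
    refine mul_left_cancel₀ (hne (n + 1)) (h1.trans ?_)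
    push_cast
    linear_combination -conj (coef 0 f) * norm_mono_recursion (ξ := ξ) n
  -- The opposite entry vanishes, since `L` lowers degrees by at most one. Taking `n = 0` and then
  -- `n = 1` removes all higher coefficients of `g` and of `f`.
  have hfar (n k : ℕ) : n * coef (k + 3) f + coef (k + 2) g = 0 := by
    have h1 := hsym n (k + 2)
    rw [diffOp_mono, inner_add_right, inner_smul_right, inner_mono_shift_lt (by omega),
      inner_mono_shift_lt (by omega), mul_zero, add_zero, map_zero] at h1
    exact (mul_eq_zero.1 h1).resolve_left (hne _)
  have hg (k : ℕ) : coef (k + 2) g = 0 := by simpa using hfar 0 k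
  have hf (k : ℕ) : coef (k + 3) f = 0 := by simpa [hg k] using hfar 1 k
  have hg0 : conj (coef 0 g) = coef 0 g := by simpa using hdiag 0
  have hf1 : conj (coef 1 f) = coef 1 f := by simpa [hg0] using hdiag 1
  obtain ⟨b, hb⟩ := Complex.conj_eq_iff_real.1 hg0
  obtain ⟨a, ha⟩ := Complex.conj_eq_iff_real.1 hf1
  have hg1 : coef 1 g = (ξ + 2) * conj (coef 0 f) := by simpa using hoff 0
  have hf2 : coef 2 f = conj (coef 0 f) := by
    have h1 := hoff 1
    rw [hg1] at h1
    push_cast at h1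
    linear_combination h1
  refine ⟨a, b, coef 2 f, ext_coef fun n => ?_, ext_coef fun n => ?_⟩
  · rw [quad, coef_add, coef_add, coef_smul, coef_smul, coef_smul]
    match n with
    | 0 => simp [coef_mono, coef_mono_self, hf2]
    | 1 => simp [coef_mono, coef_mono_self, ha]
    | 2 => simp [coef_mono, coef_mono_self]
    | k + 3 => simp [coef_mono, hf]
  · rw [lin, coef_add, coef_smul, coef_smul]
    match n with
    | 0 => simp [coef_mono, coef_mono_self, hb]
    | 1 => simp [coef_mono, coef_mono_self, hf2, hg1]
    | k + 2 => simp [coef_mono, hg]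

end DiffOp

end Bergman

end

/-! ### The theorem -/

theorem mainTheorem1 (ξ : ℝ) [Fact (-1 < ξ)] :
    (∀ (a b : ℝ) (c : ℂ) (L : Bergman.A2 ξ →ₗ.[ℂ] Bergman.A2 ξ),
      -- `L = (c z² + a z + c̄) d/dz + ((ξ + 2) c z + b)` on the polynomials
      L = Bergman.diffOp
        (Bergman.ofPoly ξ (Polynomial.C c * Polynomial.X ^ 2 +
          Polynomial.C (a : ℂ) * Polynomial.X + Polynomial.C (starRingEnd ℂ c)))
        (Bergman.ofPoly ξ (Polynomial.C (((ξ : ℂ) + 2) * c) * Polynomial.X +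
          Polynomial.C (b : ℂ))) →
      -- `L` is densely defined and symmetric
      Dense (L.domain : Set (Bergman.A2 ξ)) ∧ L.IsFormalAdjoint L ∧
      ∃ (X : Bergman.su11) (d : ℝ),
        -- `L` is the restriction of `i π_ξ(X) + d` to the polynomials
        L ≤ Bergman.iMulAdd (Bergman.derivedRep ξ X) d ∧
        -- the closure of `L` is `i Π_ξ(X) + d`, and it is self-adjoint
        L.IsClosable ∧ (Bergman.derivedRep ξ X).IsClosable ∧
        L.closure = Bergman.iMulAdd (Bergman.derivedRepClosure ξ X) d ∧
        IsSelfAdjoint L.closure) ∧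
    -- every symmetric first-order differential operator `f d/dz + g` arises in this way
    (∀ (f g : Bergman.A2 ξ) (L : Bergman.A2 ξ →ₗ.[ℂ] Bergman.A2 ξ),
      L = Bergman.diffOp f g → L.IsFormalAdjoint L →
      ∃ (X : Bergman.su11) (d : ℝ),
        L ≤ Bergman.iMulAdd (Bergman.derivedRep ξ X) d ∧
        L.IsClosable ∧ (Bergman.derivedRep ξ X).IsClosable ∧
        L.closure = Bergman.iMulAdd (Bergman.derivedRepClosure ξ X) d ∧
        IsSelfAdjoint L.closure) := by
  refine ⟨?_, ?_⟩
  · rintro a b c L rfl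
    rw [Bergman.ofPoly_quad, Bergman.ofPoly_lin]
    exact ⟨Bergman.dense_polySubmodule, Bergman.isFormalAdjoint_diffOp a b c,
      Bergman.exists_closure_diffOp_eq a b c⟩
  · rintro f g L rfl hL
    obtain ⟨a, b, c, rfl, rfl⟩ := Bergman.exists_eq_of_isFormalAdjoint hL
    exact Bergman.exists_closure_diffOp_eq a b c
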